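/- Words are finite or one-sided infinite, and the alphabet is $\{0,1,2,3\}$. A factor of a word is a finite contiguous subword, and a word avoids $v$ if $v$ is not a factor of it. For a rational $r$, a word is $r$-free (resp. $r^+$-free) if it has no factor $v$ with a period $p\ge 1$ such that $|v|/p\ge r$ (resp. $|v|/p>r$). A Dean word is a word that avoids $02$, $20$, $13$, $31$ and all words $uu$ with $u$ nonempty. For a word $w$, let $d_3(w)$ be the number of minimal absent words of $w$ of length $3$, i.e. of words $v$ of length $3$ that are not factors of $w$ while all proper prefixes and all proper suffixes of $v$ are factors of $w$. Let $h$ be the morphism given by the following images of the letters (each image is spread over several lines): $$\begin{array}{rl} h(0)=&\,\texttt{0103230121032123010321012303212301210323010321230} \\ &\,\texttt{3210123010321230121032301032101230321230121032123} \\ &\,\texttt{0321012301032301210321230103210123032123010323012} \\ &\,\texttt{1032123032101230103212301210323010321230321012301} \\ &\,\texttt{0323012103212301032101230321230121032123032101230} \\ &\,\texttt{1032123012103230103210123010323012103212301032101} \\ &\,\texttt{2303212301032301210321230321012301032123012103230} \\ &\,\texttt{103210123032123} \\ h(1)=&\,\texttt{0103230121032123010321012303212301210323010321230} \\ &\,\texttt{3210123010321230121032301032101230321230121032123}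 \\ &\,\texttt{0321012301032301210321230103210123032123010323012} \\ &\,\texttt{1032123032101230103212301210323010321012301032301} \\ &\,\texttt{2103212301032101230321230121032123032101230103212} \\ &\,\texttt{3012103230103212303210123010323012103212301032101} \\ &\,\texttt{2303212301032301210321230321012301032123012103230} \\ &\,\texttt{103210123032123} \\ h(2)=&\,\texttt{0103230121032123010321012303212301210323010321230} \\ &\,\texttt{3210123010321230121032301032101230103230121032123} \\ &\,\texttt{0103210123032123010323012103212303210123010321230} \\ &\,\texttt{1210323010321230321012301032301210321230103210123} \\ &\,\texttt{0321230121032301032101230103230121032123032101230} \\ &\,\texttt{1032123012103230103210123032123010323012103212301} \\ &\,\texttt{0321012303212301210321230321012301032123012103230} \\ &\,\texttt{103212303210123} \\ h(3)=&\,\texttt{0103230121032123010321012303212301210323010321230} \\ &\,\texttt{3210123010321230121032301032101230103230121032123} \\ &\,\texttt{0103210123032123010323012103212303210123010321230} \\ &\,\texttt{1210323010321230321012301032301210321230103210123} \\ &\,\texttt{0321230121032123032101230103212301210323010321012} \\ &\,\texttt{3032123010323012103212301032101230321230121032301} \\ &\,\texttt{0321012301032301210321230321012301032123012103230} \\ &\,\texttt{103212303210123}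 \end{array}$$ Then the following hold. 1. There is an infinite $\frac{17}{10}^+$-free Dean word that avoids $030$ and $232$. 2. The morphism $h$ is $358$-uniform, that is, $|h(a)|=358$ for each letter $a$; and for every (finite or infinite) $\frac75^+$-free word $w$ over $\{0,1,2,3\}$, the image $h(w)$ is a $\frac{17}{10}^+$-free Dean word that avoids $030$ and $232$. 3. Every $\frac{17}{10}$-free Dean word $w$ with $d_3(w)\ge 2$ satisfies $|w|<290$. -/

import Mathlib

namespace DeanWord

/-- A word over `α`, finite or (one-sided) infinite. -/
inductive Word (α : Type) where
  | fin (l : List α) : Word α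
  | inf (s : ℕ → α) : Word α

namespace Word

variable {α β : Type}

/-- The length of a word; infinite words have length `⊤`. -/
def length : Word α → ℕ∞
  | fin l => (l.length : ℕ∞)
  | inf _ => ⊤

/-- `w.IsFactor v`: the finite word `v` is a contiguous subword of `w`. -/
def IsFactor : Word α → List α → Prop
  | fin l, v => v <:+: l
  | inf s, v => ∃ i : ℕ, v = (List.range v.length).map (fun j => s (i + j))

/-- `w` avoids `v` if `v` is not a factor of `w`. -/
def Avoids (w : Word α) (v : List α) : Prop := ¬ w.IsFactor v

/-- `w` avoids all nonempty words of the form `uu`. -/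
def SquareFree (w : Word α) : Prop := ∀ u : List α, u ≠ [] → w.Avoids (u ++ u)

/-- `w` is `r`-free: it has no factor of exponent at least `r`, where a word `v` with period `p`
has exponent `|v| / p`. -/
def PowerFree (r : ℚ) (w : Word α) : Prop :=
  ∀ v : List α, w.IsFactor v → ∀ p : ℕ, 1 ≤ p → v.HasPeriod p → (v.length : ℚ) / p < r

/-- `w` is `r⁺`-free: it has no factor of exponent greater than `r`. -/
def PowerFreePlus (r : ℚ) (w : Word α) : Prop :=
  ∀ v : List α, w.IsFactor v → ∀ p : ℕ, 1 ≤ p → v.HasPeriod p → (v.length : ℚ) / p ≤ r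

/-- The minimal absent words of length `l`: the words `v` of length `l` that are not factors
of `w`, while all proper prefixes and all proper suffixes of `v` are. -/
def minimalAbsent (l : ℕ) (w : Word α) : Set (List α) :=
  {v | v.length = l ∧ w.Avoids v ∧
    ∀ u : List α, (u <+: v ∨ u <:+ v) → u ≠ v → w.IsFactor u}

/-- The number of minimal absent words of length `l` (over a finite alphabet there are only
finitely many words of length `l`). -/
noncomputable def numMinimalAbsent (l : ℕ) (w : Word α) : ℕ := (w.minimalAbsent l).ncard

/-- The image of a word under the morphism that sends each letter `a` to `h a`, where all `h a`
are nonempty. The `n`-th letter of the image of an infinite word `s` is read off the image of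
the prefix of length `n + 1` of `s`, which has length at least `n + 1`; so the default value is
never used. -/
def image [Inhabited β] (h : α → List β) : Word α → Word β
  | fin l => fin (l.flatMap h)
  | inf s => inf (fun n => (((List.range (n + 1)).map s).flatMap h).getD n default)

/-- A word over `{0, 1, 2, 3}` is reduced if no letter is adjacent to its inverse, where `0` and
`2` are inverse to each other, and so are `1` and `3`. -/
def Reduced (w : Word (Fin 4)) : Prop :=
  w.Avoids [0, 2] ∧ w.Avoids [2, 0] ∧ w.Avoids [1, 3] ∧ w.Avoids [3, 1]

/-- A Dean word is a square-free reduced word. -/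
def IsDean (w : Word (Fin 4)) : Prop := w.Reduced ∧ w.SquareFree

end Word

/-- The word of length `n` whose letters are the decimal digits of `N`, most significant first,
padded with leading zeros; for instance `block 4 0103 = [0, 1, 0, 3]`. -/
def block (n N : ℕ) : List (Fin 4) :=
  (List.range n).map (fun i => Fin.ofNat 4 (N / 10 ^ (n - 1 - i) % 10))

/-- The images of the letters under the 358-uniform morphism. -/
def morphism : Fin 4 → List (Fin 4)
  | 0 =>
      block 49 0103230121032123010321012303212301210323010321230 ++
      block 49 3210123010321230121032301032101230321230121032123 ++
      block 49 0321012301032301210321230103210123032123010323012 ++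
      block 49 1032123032101230103212301210323010321230321012301 ++
      block 49 0323012103212301032101230321230121032123032101230 ++
      block 49 1032123012103230103210123010323012103212301032101 ++
      block 49 2303212301032301210321230321012301032123012103230 ++
      block 15 103210123032123
  | 1 =>
      block 49 0103230121032123010321012303212301210323010321230 ++
      block 49 3210123010321230121032301032101230321230121032123 ++
      block 49 0321012301032301210321230103210123032123010323012 ++
      block 49 1032123032101230103212301210323010321012301032301 ++
      block 49 2103212301032101230321230121032123032101230103212 ++
      block 49 3012103230103212303210123010323012103212301032101 ++
      block 49 2303212301032301210321230321012301032123012103230 ++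
      block 15 103210123032123
  | 2 =>
      block 49 0103230121032123010321012303212301210323010321230 ++
      block 49 3210123010321230121032301032101230103230121032123 ++
      block 49 0103210123032123010323012103212303210123010321230 ++
      block 49 1210323010321230321012301032301210321230103210123 ++
      block 49 0321230121032301032101230103230121032123032101230 ++
      block 49 1032123012103230103210123032123010323012103212301 ++
      block 49 0321012303212301210321230321012301032123012103230 ++
      block 15 103212303210123
  | 3 =>
      block 49 0103230121032123010321012303212301210323010321230 ++
      block 49 3210123010321230121032301032101230103230121032123 ++
      block 49 0103210123032123010323012103212303210123010321230 ++
      block 49 1210323010321230321012301032301210321230103210123 ++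
      block 49 0321230121032123032101230103212301210323010321012 ++
      block 49 3032123010323012103212301032101230321230121032301 ++
      block 49 0321012301032301210321230321012301032123012103230 ++
      block 15 103212303210123

end DeanWord

/-!
All exponent conditions are expressed by `RepBound`: a factor of length `p + m` with period `p` has
`m ≤ μ p`.

*Images of words.* If a word has only exponents below `3 / 2`, in particular if it is
`7/5⁺`-free, then its image under the given morphism is `17/10⁺`-free. Some windows occur in
images at one residue of the position modulo the length of the images of letters only, so every
long repetition in an image has a period that is a multiple of this length. It then comes from a
repetition in the preimage and sticks out by at most the longest common prefix and suffix of images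
of letters. This is `RepBound.flatMap_uniform`; the finitely many short periods are tested on images
of short words (`directCheck`). The factors of length 2 and 3 that must not occur are read off the
images of two letters.

*An infinite word.* The same transfer shows that the 84-uniform morphism `seed` preserves the
words with exponents below `3 / 2`. So its fixed point `seedWord` is such a word, and the image of
`seedWord` under the given morphism is the infinite word that is asked for.

*Short words.* Minimal absent words of length 3 of a Dean word are walks of length 2 on the 4-cycle
`0, 1, 2, 3`. Up to the symmetries of the cycle there are 20 pairs of them, and for each pair it is
shown that no `17/10`-free walk of length 290 avoids both (`Admissible`). For 19 pairs, `easyPairs`,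
there is a word `u` that occurs in every such walk of length 40, and a search to the left of `u`
dies out soon. For the pair `{010, 212}` there is such a word of length 289, and a letter by letter
search is too long. But seven letters away from the ends, these walks are forced to follow the
arcs between four branch words, with a choice between two arcs at each of them
(`enc_mem_arcWindows`, `exists_arcWord_suffix`). So it suffices to search through the sequences
of arcs, and to test those periods that are distances of branch words; only the last letters are
searched one by one (`branchSearch`).

The finite searches are evaluated by the kernel. Words are coded by numbers in base 8 (`enc`), so
that the comparison of two factors is a division with remainder.
-/

namespace DeanWord

/-! ### Words with bounded exponents -/

/-- Exponents in a form that avoids division: whenever a factor of `l` of length `p + m` has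
period `p ≥ 1`, the excess `m` is at most `μ p`. -/
def RepBound {α : Type} (μ : ℕ → ℕ) (l : List α) : Prop :=
  ∀ i p m : ℕ, 0 < p → i + p + m ≤ l.length →
    (∀ j < m, l[i + j]? = l[i + p + j]?) → m ≤ μ p

theorem RepBound.infix {α : Type} {μ : ℕ → ℕ} {l v : List α} (h : RepBound μ l)
    (hv : v <:+: l) : RepBound μ v := by
  obtain ⟨s, t, rfl⟩ := hv
  intro i p m hp hl hm
  have key : ∀ k < v.length, (s ++ v ++ t)[s.length + k]? = v[k]? := by
    intro k hk
    rw [List.append_assoc, List.getElem?_append_right (by omega), Nat.add_sub_cancel_left,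
      List.getElem?_append_left hk]
  refine h (s.length + i) p m hp (by simp; omega) fun j hj => ?_
  rw [show s.length + i + j = s.length + (i + j) by omega,
    show s.length + i + p + j = s.length + (i + p + j) by omega,
    key _ (by omega), key _ (by omega)]
  exact hm j hj

theorem RepBound.map {α β : Type} {μ : ℕ → ℕ} {l : List α} (h : RepBound μ l) {f : α → β}
    (hf : Function.Injective f) : RepBound μ (l.map f) := by
  intro i p m hp hl hm
  refine h i p m hp (by simpa using hl) fun j hj => ?_
  have := hm j hj
  simp only [List.getElem?_map] at this
  exact Option.map_injective hf this

/-- A square `uu` is a factor with period `|u|` and excess `|u|`. -/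
theorem RepBound.not_infix_square {α : Type} {μ : ℕ → ℕ} {l u : List α} (h : RepBound μ l)
    (hμ : ∀ p, 0 < p → μ p < p) (hu : u ≠ []) : ¬ u ++ u <:+: l := by
  intro hi
  have hpos : 0 < u.length := List.length_pos_iff.2 hu
  have := h.infix hi 0 u.length u.length hpos (by simp) fun j hj => by
    rw [List.getElem?_append_left (by omega), List.getElem?_append_right (by omega)]
    congr 1; omega
  have := hμ _ hpos
  omega

theorem repBound_of_periods {α : Type} {μ : ℕ → ℕ} {l : List α}
    (h : ∀ v, v <:+: l → ∀ p, 0 < p → v.HasPeriod p → v.length ≤ p + μ p) : RepBound μ l := by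
  intro i p m hp hl hm
  have hlen : ((l.drop i).take (p + m)).length = p + m := by simp; omega
  have := h ((l.drop i).take (p + m))
    ((List.take_prefix _ _).isInfix.trans (List.drop_suffix _ _).isInfix) p hp (by
      rw [List.hasPeriod_iff_getElem?]
      intro k hk
      rw [hlen] at hk
      rw [List.getElem?_take_of_lt (by omega), List.getElem?_take_of_lt (by omega),
        List.getElem?_drop, List.getElem?_drop, hm k (by omega)]
      congr 1; omega)
  omega

theorem RepBound.length_le {α : Type} {μ : ℕ → ℕ} {v : List α} (h : RepBound μ v) {p : ℕ}
    (hp : 0 < p) (hv : v.HasPeriod p) : v.length ≤ p + μ p := by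
  by_cases hle : v.length ≤ p
  · omega
  have := h 0 p (v.length - p) hp (by omega) fun j hj => by
    have := (List.hasPeriod_iff_getElem? (w := v) (p := p)).1 hv j hj
    rw [Nat.zero_add, this]; congr 1; omega
  omega

namespace Word

variable {α β : Type}

theorem IsFactor.infix {w : Word α} {u v : List α} (h : w.IsFactor v) (hu : u <:+: v) :
    w.IsFactor u := by
  cases w with
  | fin l => exact List.IsInfix.trans hu h
  | inf s =>
    obtain ⟨i, hi⟩ := h
    obtain ⟨a, b, rfl⟩ := hu
    refine ⟨i + a.length, ?_⟩
    apply List.ext_getElem (by simp)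
    intro k hk _
    have h1 : (a ++ u ++ b)[a.length + k]? = some u[k] := by
      rw [List.append_assoc, List.getElem?_append_right (by omega), Nat.add_sub_cancel_left,
        List.getElem?_append_left hk, List.getElem?_eq_getElem hk]
    rw [hi, List.getElem?_map, List.getElem?_range (by simp; omega)] at h1
    simp only [Option.map_some, Option.some.injEq] at h1
    simp [← h1, Nat.add_assoc]

theorem exists_factor_of_le_length {w : Word α} {n : ℕ} (h : (n : ℕ∞) ≤ w.length) :
    ∃ l, w.IsFactor l ∧ l.length = n := by
  cases w with
  | fin l =>
    have : n ≤ l.length := by simpa [length] using h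
    exact ⟨l.take n, (List.take_prefix _ _).isInfix, by simpa using this⟩
  | inf s => exact ⟨(List.range n).map (fun j => s (0 + j)), ⟨0, by simp⟩, by simp⟩

theorem PowerFree.repBound {w : Word α} (h : w.PowerFree (17 / 10)) {l : List α}
    (hl : w.IsFactor l) : RepBound (fun p => (7 * p - 1) / 10) l := by
  refine repBound_of_periods fun v hv p hp hper => ?_
  have := h v (hl.infix hv) p hp hper
  rw [div_lt_iff₀ (by exact_mod_cast hp)] at this
  have h2 : (10 * v.length : ℚ) < 17 * p := by linarith
  have h3 : 10 * v.length < 17 * p := by exact_mod_cast h2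
  omega

theorem PowerFreePlus.repBound {w : Word α} (h : w.PowerFreePlus (7 / 5)) {l : List α}
    (hl : w.IsFactor l) : RepBound (fun p => (p - 1) / 2) l := by
  refine repBound_of_periods fun v hv p hp hper => ?_
  have := h v (hl.infix hv) p hp hper
  rw [div_le_iff₀ (by exact_mod_cast hp)] at this
  have h2 : (5 * v.length : ℚ) ≤ 7 * p := by linarith
  have h3 : 5 * v.length ≤ 7 * p := by exact_mod_cast h2
  omega

theorem powerFreePlus_of_repBound {w : Word α}
    (h : ∀ l, w.IsFactor l → RepBound (fun p => 7 * p / 10) l) : w.PowerFreePlus (17 / 10) := by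
  intro v hv p hp hper
  have := (h v hv).length_le hp hper
  rw [div_le_iff₀ (by exact_mod_cast hp)]
  have h3 : 10 * v.length ≤ 17 * p := by omega
  have h2 : (10 * v.length : ℚ) ≤ 17 * p := by exact_mod_cast h3
  linarith

theorem squareFree_of_repBound {w : Word α}
    (h : ∀ l, w.IsFactor l → RepBound (fun p => 7 * p / 10) l) : w.SquareFree :=
  fun u hu hf => (h _ hf).not_infix_square (fun p hp => by omega) hu (List.infix_refl _)

/-- Every factor of the image of a word lies in the image of a finite factor. -/
theorem exists_factor_of_isFactor_image [Inhabited β] {h : α → List β} (hne : ∀ a, h a ≠ [])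
    {w : Word α} {v : List β} (hv : (w.image h).IsFactor v) :
    ∃ u, w.IsFactor u ∧ v <:+: u.flatMap h := by
  cases w with
  | fin l => exact ⟨l, List.infix_refl _, hv⟩
  | inf s =>
    obtain ⟨i, hi⟩ := hv
    have hlen : ∀ n, n ≤ (((List.range n).map s).flatMap h).length := by
      intro n
      induction n with
      | zero => simp
      | succ n ih =>
        have := List.length_pos_iff.2 (hne (s n))
        simp only [List.range_succ, List.map_append, List.flatMap_append, List.length_append,
          List.map_cons, List.map_nil, List.flatMap_cons, List.flatMap_nil, List.append_nil]
        omega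
    set n := i + v.length with hn
    refine ⟨(List.range n).map s, ⟨0, by simp⟩, ?_⟩
    have hv' : v = ((((List.range n).map s).flatMap h).drop i).take v.length := by
      apply List.ext_getElem?
      intro k
      by_cases hk : k < v.length
      · rw [List.getElem?_take_of_lt hk, List.getElem?_drop]
        conv_lhs => rw [hi]
        rw [List.getElem?_map, List.getElem?_range hk]
        obtain ⟨t, ht⟩ : ((List.range (i + k + 1)).map s).flatMap h <+:
            ((List.range n).map s).flatMap h := by
          obtain ⟨d, hd⟩ : ∃ d, n = (i + k + 1) + d := ⟨n - (i + k + 1), by omega⟩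
          have hr := List.range_add (n := i + k + 1) (m := d)
          rw [hd, hr, List.map_append, List.flatMap_append]
          exact List.prefix_append _ _
        have hlt : i + k < (((List.range (i + k + 1)).map s).flatMap h).length :=
          Nat.lt_of_lt_of_le (Nat.lt_succ_self _) (hlen _)
        rw [Option.map_some, ← ht, List.getElem?_append_left hlt, List.getElem?_eq_getElem hlt]
        simp only [List.getD_eq_getElem?_getD, List.getElem?_eq_getElem hlt, Option.getD_some]
      · rw [List.getElem?_eq_none (by omega), List.getElem?_eq_none (by simp; omega)]
    rw [hv']
    exact (List.take_prefix _ _).isInfix.trans (List.drop_suffix _ _).isInfix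

end Word

/-! ### Uniform synchronizing morphisms -/

section Uniform

variable {α β : Type} {H : α → List β} {L : ℕ}

theorem length_flatMap_uniform (hL : ∀ a, (H a).length = L) (l : List α) :
    (l.flatMap H).length = l.length * L := by
  induction l with
  | nil => simp
  | cons a l ih => simp [ih, hL, Nat.add_mul, Nat.add_comm]

theorem getElem?_flatMap_uniform (hL : ∀ a, (H a).length = L) {l : List α} {b j : ℕ} {a : α}
    (ha : l[b]? = some a) (hj : j < L) : (l.flatMap H)[b * L + j]? = (H a)[j]? := by
  induction l generalizing b with
  | nil => simp at ha
  | cons c l ih =>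
    rw [List.flatMap_cons]
    cases b with
    | zero =>
      simp only [List.getElem?_cons_zero, Option.some.injEq] at ha
      subst ha
      rw [Nat.zero_mul, Nat.zero_add, List.getElem?_append_left (by rw [hL]; exact hj)]
    | succ b =>
      rw [List.getElem?_cons_succ] at ha
      rw [List.getElem?_append_right (by rw [hL, Nat.add_mul]; omega), hL, ← ih ha]
      congr 1
      rw [Nat.add_mul]; omega

theorem infix_of_append_eq_append {s v t x y z : List α} (h : s ++ v ++ t = x ++ y ++ z)
    (h1 : x.length ≤ s.length) (h2 : s.length + v.length ≤ x.length + y.length) : v <:+: y := by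
  have hx : x <+: s := List.prefix_of_prefix_length_le (l₃ := x ++ y ++ z)
    ⟨y ++ z, by simp⟩ ⟨v ++ t, by rw [← h]; simp⟩ h1
  obtain ⟨s', rfl⟩ := hx
  have h' : s' ++ v ++ t = y ++ z := by
    simpa only [List.append_assoc, List.append_cancel_left_eq] using h
  have : s' ++ v <+: y := List.prefix_of_prefix_length_le (l₃ := y ++ z)
    ⟨t, h'⟩ ⟨z, rfl⟩ (by simp only [List.length_append] at h2 ⊢; omega)
  exact (List.suffix_append s' v).isInfix.trans this.isInfix

/-- A short factor of the image of `l` is seen in the image of a few consecutive letters. -/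
theorem exists_infix_of_infix_flatMap (hL : ∀ a, (H a).length = L) (hpos : 0 < L) {l : List α}
    {v : List β} (hv : v <:+: l.flatMap H) {B : ℕ} (hB : v.length + (L - 1) ≤ B * L) :
    ∃ u, u <:+: l ∧ u.length ≤ B ∧ v <:+: u.flatMap H := by
  obtain ⟨s, t, h⟩ := hv
  set a := s.length / L with ha
  have hdecomp : l = l.take a ++ (l.drop a).take B ++ (l.drop a).drop B := by
    rw [List.append_assoc, List.take_append_drop, List.take_append_drop]
  refine ⟨(l.drop a).take B, (List.take_prefix _ _).isInfix.trans (List.drop_suffix _ _).isInfix,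
    by simp, ?_⟩
  have hlen := congrArg List.length h
  simp only [List.length_append, length_flatMap_uniform hL] at hlen
  rw [hdecomp, List.flatMap_append, List.flatMap_append] at h
  have hs : a * L + s.length % L = s.length := by rw [Nat.mul_comm]; exact Nat.div_add_mod _ _
  have hmod := Nat.mod_lt s.length hpos
  refine infix_of_append_eq_append h ?_ ?_
  · rw [length_flatMap_uniform hL, List.length_take]
    exact (Nat.mul_le_mul_right _ (Nat.min_le_left _ _)).trans (by omega)
  · rw [length_flatMap_uniform hL, length_flatMap_uniform hL, ← Nat.add_mul]
    simp only [List.length_take, List.length_drop]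
    by_cases hc : a + B ≤ l.length
    · rw [show min a l.length + min B (l.length - a) = a + B by omega, Nat.add_mul]
      omega
    · by_cases hc2 : a ≤ l.length
      · rw [show min a l.length + min B (l.length - a) = l.length by omega]
        omega
      · rw [show min a l.length + min B (l.length - a) = l.length by omega]
        omega

theorem ne_of_repBound {μ : ℕ → ℕ} {l : List α} (h : RepBound μ l) (hμ : μ 1 = 0) {b : ℕ}
    {x y : α} (hx : l[b]? = some x) (hy : l[b + 1]? = some y) : x ≠ y := by
  rintro rfl
  obtain ⟨hb, -⟩ := List.getElem?_eq_some_iff.1 hy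
  have := h b 1 1 one_pos (by omega) fun j hj => by
    obtain rfl : j = 0 := by omega
    simp only [Nat.add_zero, hx, hy]
  omega

/-- If a set of words of length `t` is seen in the images of two-letter words exactly at the
offset `c`, then it is seen in the image of any word exactly at the positions `≡ c` mod `L`. -/
theorem mark_window_iff [Nontrivial α] (hL : ∀ a, (H a).length = L) (hpos : 0 < L)
    {mark : List β → Prop} {c t : ℕ} (ht : t ≤ L)
    (hmark : ∀ a b, a ≠ b → ∀ i < L, (mark (((H a ++ H b).drop i).take t) ↔ i = c))
    {l : List α} (hl : ∀ b x y, l[b]? = some x → l[b + 1]? = some y → x ≠ y) (ht0 : 0 < t)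
    {x : ℕ} (hx : x + t ≤ (l.flatMap H).length) :
    mark (((l.flatMap H).drop x).take t) ↔ x % L = c := by
  rw [length_flatMap_uniform hL] at hx
  set b := x / L with hb
  have hxb : b * L + x % L = x := by rw [Nat.mul_comm]; exact Nat.div_add_mod _ _
  have hmod := Nat.mod_lt x hpos
  have hbl : b < l.length := by
    rw [hb, Nat.div_lt_iff_lt_mul hpos]; omega
  have hd : l.flatMap H = (l.take b).flatMap H ++ (l.drop b).flatMap H := by
    rw [← List.flatMap_append, List.take_append_drop]
  have htake : ((l.take b).flatMap H).length = b * L := by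
    rw [length_flatMap_uniform hL, List.length_take, Nat.min_eq_left hbl.le]
  have hdrop : (l.flatMap H).drop x = ((l.drop b).flatMap H).drop (x % L) := by
    conv_lhs => rw [← hxb, ← List.drop_drop, hd, ← htake, List.drop_left]
  rw [hdrop, List.drop_eq_getElem_cons hbl, List.flatMap_cons]
  rcases hr : l.drop (b + 1) with _ | ⟨y, rest⟩
  · obtain ⟨y, hy⟩ := exists_ne l[b]
    rw [← hmark _ _ hy.symm _ hmod]
    have hlen : l.length ≤ b + 1 := by
      have := congrArg List.length hr
      rw [List.length_drop, List.length_nil] at this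
      omega
    have hL1 : b * L + L = l.length * L := by
      rw [show l.length = b + 1 by omega, Nat.add_mul, Nat.one_mul]
    have hfit : x % L + t ≤ (H l[b]).length := by rw [hL]; omega
    rw [List.flatMap_nil, List.append_nil, List.drop_append_of_le_length (by omega),
      List.take_append_of_le_length (by simp; omega)]
  · have hy : l[b + 1]? = some y := by
      have := congrArg (fun m => m[0]?) hr
      simpa using this
    rw [← hmark _ _ (hl b _ _ (List.getElem?_eq_getElem hbl) hy) _ hmod, List.flatMap_cons,
      ← List.append_assoc, List.drop_append_of_le_length (by simp [hL]; omega),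
      List.take_append_of_le_length (by simp [hL]; omega)]

/-- **Transfer of exponent bounds along a uniform synchronizing morphism.**
Periods up to `P` are controlled by the images of short words. A repetition with
a longer period contains a marker, so its period is a multiple `q * L`; it then comes from `k`
equal letters at distance `q`, and overhangs by at most `S` on the left and `Q` on the right,
because distinct letters have images with common suffix at most `S` and common prefix at most
`Q`. -/
theorem RepBound.flatMap_uniform [Nontrivial α] {μ : ℕ → ℕ} {P Q S c t : ℕ}
    {mark : List β → Prop} (hL : ∀ a, (H a).length = L) (hpos : 0 < L)
    (hdirect : ∀ u, RepBound (fun p => (p - 1) / 2) u → ∀ i p, 0 < p → p ≤ P →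
      u.length * L ≤ p + (μ p + 1) + 2 * L → i + p + (μ p + 1) ≤ (u.flatMap H).length →
      ¬ ∀ j < μ p + 1, (u.flatMap H)[i + j]? = (u.flatMap H)[i + p + j]?)
    (ht0 : 0 < t) (ht : t ≤ L) (hc : c < L)
    (hmark : ∀ a b, a ≠ b → ∀ i < L, (mark (((H a ++ H b).drop i).take t) ↔ i = c))
    (hQ : ∀ a b, a ≠ b → ∃ j ≤ Q, j < L ∧ (H a)[j]? ≠ (H b)[j]?)
    (hS : ∀ a b, a ≠ b → ∃ j < L, L ≤ j + 1 + S ∧ (H a)[j]? ≠ (H b)[j]?)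
    (hμL : ∀ p, P < p → L + t ≤ μ p + 2)
    (hμq : ∀ q k, P < q * L → 2 * k < q → k * L + Q + S ≤ μ (q * L))
    {l : List α} (hl : RepBound (fun p => (p - 1) / 2) l) : RepBound μ (l.flatMap H) := by
  intro i p m hp hi hm
  by_contra! hlt
  rcases Nat.lt_or_ge P p with hPp | hpP
  · -- long periods
    have hm1 := hμL p hPp
    have hnext : ∀ b x y, l[b]? = some x → l[b + 1]? = some y → x ≠ y :=
      fun b x y => ne_of_repBound hl (by simp)
    have hlen := length_flatMap_uniform hL l
    -- a position of the repetition that carries a marker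
    obtain ⟨x, hix, hxi, hxc⟩ : ∃ x, i ≤ x ∧ x < i + L ∧ x % L = c := by
      by_cases h : i % L ≤ c
      · refine ⟨i + (c - i % L), by omega, by omega, ?_⟩
        have : i + (c - i % L) = c + L * (i / L) := by have := Nat.div_add_mod i L; omega
        rw [this, Nat.add_mul_mod_self_left, Nat.mod_eq_of_lt hc]
      · have hi' := Nat.mod_lt i hpos
        refine ⟨i + (c + L - i % L), by omega, by omega, ?_⟩
        have : i + (c + L - i % L) = c + L * (i / L + 1) := by
          have := Nat.div_add_mod i L; rw [Nat.mul_add]; omega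
        rw [this, Nat.add_mul_mod_self_left, Nat.mod_eq_of_lt hc]
    have hwin : ((l.flatMap H).drop x).take t = ((l.flatMap H).drop (x + p)).take t := by
      apply List.ext_getElem?
      intro k
      by_cases hk : k < t
      · rw [List.getElem?_take_of_lt hk, List.getElem?_take_of_lt hk, List.getElem?_drop,
          List.getElem?_drop]
        have := hm (x - i + k) (by omega)
        rwa [show i + (x - i + k) = x + k by omega,
          show i + p + (x - i + k) = x + p + k by omega] at this
      · rw [List.getElem?_eq_none (by simp; omega), List.getElem?_eq_none (by simp; omega)]
    have hxp : (x + p) % L = c := by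
      rw [← mark_window_iff hL hpos ht hmark hnext ht0 (by omega), ← hwin,
        mark_window_iff hL hpos ht hmark hnext ht0 (by omega)]
      exact hxc
    obtain ⟨q, rfl⟩ : ∃ q, p = q * L := by
      have h1 : x + p ≡ x + 0 [MOD L] := by
        rw [Nat.ModEq, Nat.add_zero, hxp, hxc]
      have h2 : p ≡ 0 [MOD L] := Nat.ModEq.add_left_cancel' x h1
      obtain ⟨q, hq⟩ := (Nat.modEq_zero_iff_dvd.1 h2)
      exact ⟨q, by rw [hq, Nat.mul_comm]⟩
    have hq : 0 < q := by
      rcases Nat.eq_zero_or_pos q with rfl | h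
      · simp at hp
      · exact h
    -- the blocks that meet the repetition
    set e := i / L with he
    set f := (i + m) / L with hf
    have hie : e * L + i % L = i := by rw [Nat.mul_comm]; exact Nat.div_add_mod _ _
    have hif : f * L + (i + m) % L = i + m := by rw [Nat.mul_comm]; exact Nat.div_add_mod _ _
    have hie' := Nat.mod_lt i hpos
    have hif' := Nat.mod_lt (i + m) hpos
    have hef : e < f := by
      by_contra hcon
      have : f * L ≤ e * L := Nat.mul_le_mul_right _ (by omega)
      omega
    have hblock : ∀ b, b + q < l.length →
        ((∀ j, j ≤ Q → j < L → i ≤ b * L + j ∧ b * L + j < i + m) ∨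
          (∀ j, j < L → L ≤ j + 1 + S → i ≤ b * L + j ∧ b * L + j < i + m)) →
        l[b]? = l[b + q]? := by
      intro b hb hor
      obtain ⟨y, hy⟩ : ∃ y, l[b]? = some y := ⟨_, List.getElem?_eq_getElem (by omega)⟩
      obtain ⟨y', hy'⟩ : ∃ y, l[b + q]? = some y := ⟨_, List.getElem?_eq_getElem hb⟩
      by_contra hne
      rw [hy, hy', Option.some.injEq] at hne
      have hdiff : ∀ j < L, (H y)[j]? ≠ (H y')[j]? → ¬ (i ≤ b * L + j ∧ b * L + j < i + m) := by
        rintro j hj hne ⟨h1, h2⟩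
        apply hne
        rw [← getElem?_flatMap_uniform hL hy hj, ← getElem?_flatMap_uniform hL hy' hj]
        have := hm (b * L + j - i) (by omega)
        rwa [show i + (b * L + j - i) = b * L + j by omega,
          show i + q * L + (b * L + j - i) = (b + q) * L + j by rw [Nat.add_mul]; omega] at this
      rcases hor with h | h
      · obtain ⟨j, hj, hjL, hne'⟩ := hQ y y' hne
        exact hdiff j hjL hne' (h j hj hjL)
      · obtain ⟨j, hjL, hj, hne'⟩ := hS y y' hne
        exact hdiff j hjL hne' (h j hjL hj)
    obtain ⟨e', he1, he2, he3⟩ : ∃ e', e ≤ e' ∧ e' ≤ e + 1 ∧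
        ((e' = e ∧ S < L - i % L) ∨ (e' = e + 1 ∧ L - i % L ≤ S)) := by
      by_cases h : S < L - i % L
      · exact ⟨e, by omega, by omega, Or.inl ⟨rfl, h⟩⟩
      · exact ⟨e + 1, by omega, by omega, Or.inr ⟨rfl, by omega⟩⟩
    obtain ⟨f', hf1, hf2, hf3⟩ : ∃ f', f ≤ f' ∧ f' ≤ f + 1 ∧
        ((f' = f + 1 ∧ Q < (i + m) % L) ∨ (f' = f ∧ (i + m) % L ≤ Q)) := by
      by_cases h : Q < (i + m) % L
      · exact ⟨f + 1, by omega, by omega, Or.inl ⟨rfl, h⟩⟩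
      · exact ⟨f, by omega, by omega, Or.inr ⟨rfl, by omega⟩⟩
    have hfl : f' + q ≤ l.length := by
      rw [hlen] at hi
      rcases hf3 with ⟨rfl, h⟩ | ⟨rfl, h⟩
      · have : (f + q) * L < l.length * L := by rw [Nat.add_mul]; omega
        have := Nat.lt_of_mul_lt_mul_right this
        omega
      · have : (f + q) * L ≤ l.length * L := by rw [Nat.add_mul]; omega
        exact Nat.le_of_mul_le_mul_right this hpos
    have hk := hl e' q (f' - e') hq (by omega) fun j hj => by
      have hj' : e' + j < f' := by omega
      rw [show e' + q + j = e' + j + q by omega]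
      refine hblock _ (by omega) ?_
      rcases Nat.lt_or_ge (e' + j) f with hlt' | hge
      · have h1 : (e' + j + 1) * L ≤ f * L := Nat.mul_le_mul_right _ hlt'
        rw [Nat.add_mul, Nat.one_mul] at h1
        right
        intro k hk hkS
        rcases Nat.eq_or_lt_of_le (show e ≤ e' + j by omega) with heq | hgt
        · rw [← heq] at h1 ⊢
          rcases he3 with ⟨_, h⟩ | ⟨_, h⟩ <;> omega
        · have h2 : (e + 1) * L ≤ (e' + j) * L := Nat.mul_le_mul_right _ hgt
          rw [Nat.add_mul, Nat.one_mul] at h2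
          omega
      · left
        intro k hkQ hkL
        have heq : e' + j = f := by omega
        rw [heq]
        have h2 : (e + 1) * L ≤ f * L := Nat.mul_le_mul_right _ hef
        rw [Nat.add_mul, Nat.one_mul] at h2
        rcases hf3 with ⟨_, h⟩ | ⟨_, h⟩ <;> omega
    have hbound := hμq q (f' - e') hPp (by simp only at hk; omega)
    have hmul : (f' - e') * L = f' * L - e' * L := Nat.sub_mul _ _ _
    have h2 : (e + 1) * L ≤ f * L := Nat.mul_le_mul_right _ hef
    rw [Nat.add_mul, Nat.one_mul] at h2
    rcases he3 with ⟨rfl, h⟩ | ⟨rfl, h⟩ <;> rcases hf3 with ⟨rfl, h'⟩ | ⟨rfl, h'⟩ <;>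
      (try simp only [Nat.add_mul, Nat.one_mul] at hmul) <;> omega
  · -- short periods
    have hv : ((l.flatMap H).drop i).take (p + (μ p + 1)) <:+: l.flatMap H :=
      (List.take_prefix _ _).isInfix.trans (List.drop_suffix _ _).isInfix
    have hvlen : (((l.flatMap H).drop i).take (p + (μ p + 1))).length = p + (μ p + 1) := by
      simp only [List.length_take, List.length_drop]; omega
    obtain ⟨B, hB, hB'⟩ : ∃ B, p + (μ p + 1) + (L - 1) ≤ B * L ∧
        B * L ≤ p + (μ p + 1) + 2 * L := by
      refine ⟨(p + (μ p + 1) + (L - 1)) / L + 1, ?_, ?_⟩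
      · rw [Nat.mul_comm]; exact (Nat.lt_mul_div_succ _ hpos).le
      · have := Nat.div_mul_le_self (p + (μ p + 1) + (L - 1)) L
        rw [Nat.add_mul]; omega
    obtain ⟨u, hul, huB, s, r, hvu⟩ :=
      exists_infix_of_infix_flatMap hL hpos hv (B := B) (by rw [hvlen]; exact hB)
    have key : ∀ k < p + (μ p + 1), (u.flatMap H)[s.length + k]? = (l.flatMap H)[i + k]? := by
      intro k hk
      rw [← hvu, List.append_assoc, List.getElem?_append_right (by omega),
        Nat.add_sub_cancel_left, List.getElem?_append_left (by omega),
        List.getElem?_take_of_lt hk, List.getElem?_drop]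
    refine hdirect u (hl.infix hul) s.length p hp hpP ((Nat.mul_le_mul_right _ huB).trans hB') ?_
      fun j hj => ?_
    · rw [← hvu]; simp only [List.length_append, hvlen]; omega
    · rw [show s.length + p + j = s.length + (p + j) by omega, key _ (by omega),
        key _ (by omega), hm j (by omega)]
      congr 1; omega

end Uniform

/-! ### Encoding of words by numbers -/

/-- The word `l` as a number in base 8: the letter `a` becomes the digit `4 + a`, and the first
letter is the lowest digit. As no digit is zero, the length of the word can be read off. -/
def enc : List (Fin 4) → ℕ
  | [] => 0
  | a :: l => Nat.add (Nat.add 4 a) (Nat.mul 8 (enc l))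

theorem enc_cons (a : Fin 4) (l : List (Fin 4)) : enc (a :: l) = 2 ^ 3 * enc l + (4 + a) := by
  change 4 + (a : ℕ) + 8 * enc l = _
  omega

theorem enc_append (l r : List (Fin 4)) : enc (l ++ r) = enc l + 8 ^ l.length * enc r := by
  induction l with
  | nil => simp [enc]
  | cons a l ih =>
    rw [List.cons_append, enc_cons, enc_cons, ih, List.length_cons, pow_succ]
    ring

theorem enc_lt (l : List (Fin 4)) : enc l < 8 ^ l.length := by
  induction l with
  | nil => simp [enc]
  | cons a l ih =>
    rw [enc_cons, List.length_cons, pow_succ]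
    have := a.isLt
    omega

theorem enc_drop (l : List (Fin 4)) (p : ℕ) : enc (l.drop p) = enc l / 8 ^ p := by
  rcases Nat.le_total l.length p with h | h
  · rw [List.drop_eq_nil_of_le h, Nat.div_eq_of_lt]
    · rfl
    · exact (enc_lt l).trans_le (Nat.pow_le_pow_right (by norm_num) h)
  · conv_rhs => rw [← List.take_append_drop p l, enc_append, List.length_take, Nat.min_eq_left h]
    have := enc_lt (l.take p)
    rw [List.length_take, Nat.min_eq_left h] at this
    rw [Nat.add_mul_div_left _ _ (by positivity), Nat.div_eq_of_lt this, Nat.zero_add]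

theorem enc_take (l : List (Fin 4)) (m : ℕ) : enc (l.take m) = enc l % 8 ^ m := by
  rcases Nat.le_total l.length m with h | h
  · rw [List.take_of_length_le h, Nat.mod_eq_of_lt]
    exact (enc_lt l).trans_le (Nat.pow_le_pow_right (by norm_num) h)
  · conv_rhs => rw [← List.take_append_drop m l, enc_append, List.length_take, Nat.min_eq_left h]
    have := enc_lt (l.take m)
    rw [List.length_take, Nat.min_eq_left h] at this
    rw [Nat.add_mul_mod_self_left, Nat.mod_eq_of_lt this]

theorem enc_injective : Function.Injective enc := by
  intro l
  induction l with
  | nil =>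
    intro r h
    cases r with
    | nil => rfl
    | cons b r => rw [enc_cons] at h; simp only [enc] at h; omega
  | cons a l ih =>
    intro r h
    cases r with
    | nil => rw [enc_cons] at h; simp only [enc] at h; omega
    | cons b r =>
      rw [enc_cons, enc_cons] at h
      have ha := a.isLt
      have hb := b.isLt
      rw [ih (show enc l = enc r by omega), Fin.ext (show (a : ℕ) = b by omega)]

/-- The bits of the code in position `3 * x + b` with `b < 3` depend on the letter at `x`. -/
theorem testBit_enc (l : List (Fin 4)) (x b : ℕ) (hb : b < 3) :
    (enc l).testBit (3 * x + b) = (l[x]?.elim false fun a => (4 + (a : ℕ)).testBit b) := by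
  induction l generalizing x with
  | nil => simp [enc]
  | cons a l ih =>
    have ha := a.isLt
    rw [enc_cons, Nat.testBit_two_pow_mul_add _ (by omega)]
    cases x with
    | zero => simp [hb]
    | succ x =>
      rw [if_neg (by omega), show 3 * (x + 1) + b - 3 = 3 * x + b by omega, ih]
      simp

/-- `force n f` is `f n`; the recursor makes the kernel evaluate `n` before it enters `f`. -/
def force {α : Type} (n : ℕ) (f : ℕ → α) : α :=
  Nat.rec (motive := fun _ => α) (f 0) (fun k _ => f (Nat.succ k)) n

theorem force_eq {α : Type} (n : ℕ) (f : ℕ → α) : force n f = f n := by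
  cases n <;> rfl

/-- `forceBig n f` is `f n`, too. What is substituted into `f` is not `n` itself but a number that
determines it and has the residue of `n` modulo a prime as its low bits: terms are hashed by the
low bits of their literals, and many numbers below agree in these. -/
def forceBig {α : Type} (n : ℕ) (f : ℕ → α) : α :=
  force (Nat.add (Nat.mul n (Nat.pow 2 61)) (Nat.mod n (Nat.sub (Nat.pow 2 61) 1))) fun v =>
    f (Nat.div v (Nat.pow 2 61))

theorem forceBig_eq {α : Type} (n : ℕ) (f : ℕ → α) : forceBig n f = f n := by
  rw [forceBig, force_eq]
  congr 1
  change (n * 2 ^ 61 + n % (2 ^ 61 - 1)) / 2 ^ 61 = n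
  omega

/-! ### Absence of repetitions in all positions at once -/

/-- `erode k m s z` is true only if no `m - s + 1` consecutive of the bits `3 * i` of `z` are set.
If `z` shows where the windows of length `s` consist of zeros, `z &&& (z >>> 3 * t)` shows this
for the windows of length `s + t`; so the length `m` is reached in few steps. -/
def erode (k m : ℕ) : ℕ → ℕ → Bool :=
  Nat.rec (motive := fun _ => ℕ → ℕ → Bool) (fun _ _ => false)
    (fun _ ih s z => cond (Nat.beq z 0) true (cond (Nat.ble m s) false
      (force (Nat.sub m s) fun r => force (cond (Nat.ble r s) r s) fun t =>
        force (Nat.add s t) fun s' =>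
          forceBig (Nat.land z (Nat.shiftRight z (Nat.mul 3 t))) fun z' => ih s' z'))) k

theorem erode_eq_false {k m s z i : ℕ} (hs : s ≤ m)
    (hz : ∀ j ≤ m - s, z.testBit (3 * (i + j)) = true) : erode k m s z = false := by
  induction k generalizing s z with
  | zero => rfl
  | succ k ih =>
    have he : erode (k + 1) m s z = cond (Nat.beq z 0) true (cond (Nat.ble m s) false
      (force (m - s) fun r => force (cond (Nat.ble r s) r s) fun t => force (s + t) fun s' =>
        forceBig (z &&& (z >>> (3 * t))) fun z' => erode k m s' z')) := rfl
    have hz0 : Nat.beq z 0 = false := by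
      rw [← Bool.not_eq_true, Nat.beq_eq]
      rintro rfl
      simpa using hz 0 (Nat.zero_le _)
    rw [he, hz0, cond_false, force_eq, force_eq, force_eq, forceBig_eq]
    rcases hm : Nat.ble m s with _ | _
    · obtain ⟨t, ht, htm⟩ : ∃ t, cond (Nat.ble (m - s) s) (m - s) s = t ∧ t ≤ m - s := by
        refine ⟨_, rfl, ?_⟩
        rcases hc : Nat.ble (m - s) s with _ | _
        · rw [cond_false]
          have : ¬ m - s ≤ s := fun h => by rw [Nat.ble_eq_true_of_le h] at hc; cases hc
          omega
        · rfl
      rw [cond_false, ht]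
      refine ih (by omega) fun j hj => ?_
      rw [Nat.testBit_and, Nat.testBit_shiftRight, hz j (by omega), Bool.true_and,
        show 3 * t + 3 * (i + j) = 3 * (i + (t + j)) by ring]
      exact hz _ (by omega)
    · rfl

theorem testBit_repunit (k i : ℕ) (h : i < k) : ((8 ^ k - 1) / 7).testBit (3 * i) = true := by
  induction k generalizing i with
  | zero => omega
  | succ k ih =>
    have h7 : 7 ∣ 8 ^ k - 1 := by simpa using Nat.sub_dvd_pow_sub_pow 8 1 k
    have hpos : 0 < 8 ^ k := by positivity
    have : (8 ^ (k + 1) - 1) / 7 = 2 ^ 3 * ((8 ^ k - 1) / 7) + 1 := by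
      rw [pow_succ]; omega
    rw [this, Nat.testBit_two_pow_mul_add _ (by norm_num)]
    cases i with
    | zero => simp
    | succ i =>
      rw [if_neg (by omega), show 3 * (i + 1) - 3 = 3 * i by omega]
      exact ih i (by omega)

/-- The word with code `w` has no repetition of period `p` and excess `m`: the exclusive or of `w`
with its shift shows where they differ. The number `r` has the bits `3 * i`, where `i` is less
than the length of the word. -/
def noRep (r w p m : ℕ) : Bool :=
  forceBig (Nat.xor w (Nat.shiftRight w (Nat.mul 3 p))) fun d =>
    forceBig (Nat.xor r (Nat.land r
      (Nat.lor d (Nat.lor (Nat.shiftRight d 1) (Nat.shiftRight d 2))))) fun e => erode 12 m 1 e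

theorem not_rep_of_noRep {l : List (Fin 4)} {p m i : ℕ} (hm : 0 < m)
    (h : noRep ((8 ^ l.length - 1) / 7) (enc l) p m = true) (hi : i + p + m ≤ l.length) :
    ¬ ∀ j < m, l[i + j]? = l[i + p + j]? := by
  intro hrep
  set d := enc l ^^^ (enc l >>> (3 * p)) with hd
  set r := (8 ^ l.length - 1) / 7 with hr
  have hn : noRep r (enc l) p m = forceBig d fun d =>
      forceBig (r ^^^ (r &&& (d ||| (d >>> 1 ||| d >>> 2)))) fun e => erode 12 m 1 e := rfl
  rw [hn, forceBig_eq, forceBig_eq, erode_eq_false (i := i) hm] at h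
  · cases h
  intro j hj
  have key : ∀ b < 3, d.testBit (3 * (i + j) + b) = false := by
    intro b hb
    rw [hd, Nat.testBit_xor, Nat.testBit_shiftRight,
      show 3 * p + (3 * (i + j) + b) = 3 * (i + p + j) + b by ring, testBit_enc _ _ _ hb,
      testBit_enc _ _ _ hb, hrep j (by omega), Bool.xor_self]
  rw [Nat.testBit_xor, Nat.testBit_and, testBit_repunit _ _ (by omega), Nat.testBit_or,
    Nat.testBit_or, Nat.testBit_shiftRight, Nat.testBit_shiftRight, Nat.add_comm 1,
    Nat.add_comm 2, key 1 (by norm_num), key 2 (by norm_num)]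
  have h0 := key 0 (by norm_num)
  rw [Nat.add_zero] at h0
  rw [h0]
  rfl

/-- `noRep` for all periods from `1` to `P` with the least excess above the bound `μ`, except for
those whose repetitions are more than `e` shorter than the word. -/
def noReps (μ : ℕ → ℕ) (e w n P : ℕ) : Bool :=
  force (Nat.div (Nat.sub (Nat.pow 8 n) 1) 7) fun r => Nat.rec (motive := fun _ => Bool) true
    (fun k ih => cond (force (Nat.succ k) fun p => force (Nat.succ (μ p)) fun m =>
      cond (Nat.ble n (Nat.add (Nat.add p m) e)) (noRep r w p m) true) ih false) P

theorem noRep_of_noReps {μ : ℕ → ℕ} {e w n P : ℕ} (h : noReps μ e w n P = true) {p : ℕ}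
    (hp : 0 < p) (hP : p ≤ P) (hn : n ≤ p + (μ p + 1) + e) :
    noRep ((8 ^ n - 1) / 7) w p (μ p + 1) = true := by
  induction P with
  | zero => omega
  | succ k ih =>
    set r := (8 ^ n - 1) / 7 with hr
    have hs : ∀ j, noReps μ e w n j = force r fun r => Nat.rec (motive := fun _ => Bool) true
      (fun k ih => cond (force (k + 1) fun p => force (μ p + 1) fun m =>
        cond (Nat.ble n (p + m + e)) (noRep r w p m) true) ih false) j := fun _ => rfl
    rw [hs, force_eq] at h ih
    dsimp only at h
    rw [force_eq, force_eq] at h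
    rcases hc : cond (Nat.ble n (k + 1 + (μ (k + 1) + 1) + e))
      (noRep r w (k + 1) (μ (k + 1) + 1)) true with _ | _
    · rw [hc] at h; simp at h
    · rw [hc, cond_true] at h
      rcases Nat.lt_or_ge p (k + 1) with hlt | hge
      · exact ih h (by omega)
      · obtain rfl : p = k + 1 := by omega
        rwa [Nat.ble_eq_true_of_le hn, cond_true] at hc

/-! ### Images of short words -/

/-- Necessary condition for `a :: u` to have only exponents below `3 / 2`. -/
def canCons (a : Fin 4) : List (Fin 4) → Bool
  | [] => true
  | [b] => a != b
  | [b, c] => a != b && a != c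
  | [b, c, _] => a != b && a != c
  | b :: c :: d :: e :: _ => a != b && a != c && !(a == d && b == e)

theorem canCons_of_repBound {a : Fin 4} {u : List (Fin 4)}
    (h : RepBound (fun p => (p - 1) / 2) (a :: u)) : canCons a u = true := by
  have h1 : ∀ b, u[0]? = some b → a ≠ b := fun b hb =>
    ne_of_repBound h (by simp) (b := 0) (by simp) (by simpa using hb)
  have h2 : ∀ b, u[1]? = some b → a ≠ b := by
    rintro b hb rfl
    obtain ⟨hlt, -⟩ := List.getElem?_eq_some_iff.1 hb
    have := h 0 2 1 (by norm_num) (by simp; omega) fun j hj => by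
      obtain rfl : j = 0 := by omega
      simp [hb]
    simp at this
  have h3 : ∀ d e, u[2]? = some d → u[3]? = some e → ¬ (a = d ∧ u[0]? = some e) := by
    rintro d e hd he ⟨rfl, hb⟩
    obtain ⟨hlt, -⟩ := List.getElem?_eq_some_iff.1 he
    have := h 0 3 2 (by norm_num) (by simp; omega) fun j hj => by
      obtain rfl | rfl : j = 0 ∨ j = 1 := by omega
      · simp [hd]
      · simp [he, hb]
    simp at this
  match u, h1, h2, h3 with
  | [], _, _, _ => rfl
  | [b], h1, _, _ => simpa [canCons] using h1
  | [b, c], h1, h2, _ => simp [canCons] at *; exact ⟨h1, h2⟩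
  | [b, c, _], h1, h2, _ => simp [canCons] at *; exact ⟨h1, h2⟩
  | b :: c :: d :: e :: _, h1, h2, h3 =>
    simp [canCons] at *
    exact ⟨⟨h1, h2⟩, by tauto⟩

/-- The images of all words of length at most `fuel + |u|` with suffix `u` that can be built with
`canCons` pass the test `chk`, which is given the length and the code of the image. Here `w` and
`n` are the code and the length of the image of `u`, and the images of the letters have length
`L` and codes `c a`. -/
def explore (c : Fin 4 → ℕ) (L : ℕ) (chk : ℕ → ℕ → Bool) :
    ℕ → List (Fin 4) → ℕ → ℕ → Bool
  | 0, _, n, w => chk n w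
  | k + 1, u, n, w => chk n w && [0, 1, 2, 3].all fun a => !canCons a u ||
      forceBig (Nat.add (c a) (Nat.mul (Nat.pow 8 L) w)) fun w' => force (Nat.add n L) fun n' =>
        explore c L chk k (a :: u) n' w'

theorem explore_sound {H : Fin 4 → List (Fin 4)} {L : ℕ} (hL : ∀ a, (H a).length = L)
    {c : Fin 4 → ℕ} (hc : ∀ a, c a = enc (H a)) {chk : ℕ → ℕ → Bool} {k : ℕ}
    {v u : List (Fin 4)}
    (h : explore c L chk k u (u.flatMap H).length (enc (u.flatMap H)) = true)
    (hv : v.length ≤ k) (hvu : RepBound (fun p => (p - 1) / 2) (v ++ u)) :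
    chk ((v ++ u).flatMap H).length (enc ((v ++ u).flatMap H)) = true := by
  induction k generalizing v u with
  | zero =>
    obtain rfl : v = [] := List.length_eq_zero_iff.1 (by omega)
    simpa [explore] using h
  | succ k ih =>
    rw [explore, Bool.and_eq_true, List.all_eq_true] at h
    rcases List.eq_nil_or_concat v with rfl | ⟨v', a, rfl⟩
    · exact h.1
    · rw [List.concat_eq_append, List.append_assoc, List.singleton_append] at hvu ⊢
      refine ih ?_ (by simpa using hv) hvu
      have ha := h.2 a (by fin_cases a <;> simp)
      rw [canCons_of_repBound (hvu.infix (List.suffix_append _ _).isInfix), Bool.not_true,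
        Bool.false_or, forceBig_eq, force_eq] at ha
      have hw : enc ((a :: u).flatMap H) = c a + 8 ^ L * enc (u.flatMap H) := by
        rw [List.flatMap_cons, enc_append, hL, hc]
      have hn : ((a :: u).flatMap H).length = (u.flatMap H).length + L := by
        rw [List.flatMap_cons, List.length_append, hL, Nat.add_comm]
      rw [hw, hn]
      exact ha

/-! ### Tests for uniform morphisms -/

/-- The codes of the images of the four letters, evaluated once, are passed on to `f`. -/
def withCodes (H : Fin 4 → List (Fin 4)) (f : (Fin 4 → ℕ) → Bool) : Bool :=
  force (enc (H 0)) fun c₀ => force (enc (H 1)) fun c₁ => force (enc (H 2)) fun c₂ =>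
    force (enc (H 3)) fun c₃ => f fun a => match a with
      | 0 => c₀
      | 1 => c₁
      | 2 => c₂
      | 3 => c₃

theorem withCodes_eq (H : Fin 4 → List (Fin 4)) (f : (Fin 4 → ℕ) → Bool) :
    withCodes H f = f fun a => enc (H a) := by
  simp only [withCodes, force_eq]
  congr 1
  funext a
  fin_cases a <;> rfl

/-- No image of a word has a repetition of period at most `P` whose excess is over the bound `μ`;
for each period, this is tested on words just long enough for their images to show all such
repetitions. The test sees words of length at most `B`. -/
def directCheck (H : Fin 4 → List (Fin 4)) (L B P : ℕ) (μ : ℕ → ℕ) : Bool :=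
  withCodes H fun c => explore c L (fun n w => noReps μ (Nat.mul 2 L) w n P) B [] 0 0

theorem not_rep_of_directCheck {H : Fin 4 → List (Fin 4)} {L B P : ℕ} {μ : ℕ → ℕ}
    (hL : ∀ a, (H a).length = L) (h : directCheck H L B P μ = true)
    (hB : ∀ p ≤ P, p + (μ p + 1) + 2 * L < (B + 1) * L)
    (u : List (Fin 4)) (hu : RepBound (fun p => (p - 1) / 2) u)
    (i p : ℕ) (hp : 0 < p) (hP : p ≤ P) (hup : u.length * L ≤ p + (μ p + 1) + 2 * L)
    (hi : i + p + (μ p + 1) ≤ (u.flatMap H).length) :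
    ¬ ∀ j < μ p + 1, (u.flatMap H)[i + j]? = (u.flatMap H)[i + p + j]? := by
  rw [directCheck, withCodes_eq] at h
  have huB : u.length ≤ B :=
    Nat.le_of_lt_succ (Nat.lt_of_mul_lt_mul_right (hup.trans_lt (hB p hP)))
  have := explore_sound hL (fun _ => rfl) (v := u) (u := []) h huB (by simpa using hu)
  rw [List.append_nil] at this
  refine not_rep_of_noRep (Nat.succ_pos _) (noRep_of_noReps this hp hP ?_) hi
  rw [length_flatMap_uniform hL]
  exact hup

/-- In the images of words of two distinct letters, the windows of length `t` with code in `U`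
are those at offset `c`. -/
def markCheck (H : Fin 4 → List (Fin 4)) (L c t : ℕ) (U : List ℕ) : Bool :=
  withCodes H fun e => [0, 1, 2, 3].all fun a => [0, 1, 2, 3].all fun b => a == b ||
    force (Nat.add (e a) (Nat.mul (Nat.pow 8 L) (e b))) fun w => (List.range L).all fun i =>
      force (Nat.mod (Nat.div w (Nat.pow 8 i)) (Nat.pow 8 t)) fun v =>
        U.any (fun x => Nat.beq v x) == Nat.beq i c

theorem mark_of_markCheck {H : Fin 4 → List (Fin 4)} {L c t : ℕ} {U : List ℕ}
    (hL : ∀ a, (H a).length = L) (h : markCheck H L c t U = true) (a b : Fin 4) (hab : a ≠ b)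
    (i : ℕ) (hi : i < L) : enc (((H a ++ H b).drop i).take t) ∈ U ↔ i = c := by
  rw [markCheck, withCodes_eq, List.all_eq_true] at h
  have h1 := h a (by fin_cases a <;> simp)
  rw [List.all_eq_true] at h1
  have h2 := h1 b (by fin_cases b <;> simp)
  rw [force_eq, Bool.or_eq_true, beq_iff_eq, List.all_eq_true] at h2
  have h3 := (h2.resolve_left hab) i (List.mem_range.2 hi)
  rw [force_eq, beq_iff_eq] at h3
  rw [enc_take, enc_drop, enc_append, hL]
  change (U.any fun x => Nat.beq ((enc (H a) + 8 ^ L * enc (H b)) / 8 ^ i % 8 ^ t) x) =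
    Nat.beq i c at h3
  rw [← Nat.beq_eq, ← h3, List.any_eq_true]
  constructor
  · exact fun hm => ⟨_, hm, by rw [Nat.beq_eq]⟩
  · rintro ⟨x, hx, he⟩
    rw [Nat.beq_eq] at he
    rwa [he]

/-- The images of words of two distinct letters avoid the word `v`. -/
def avoidCheck (H : Fin 4 → List (Fin 4)) (L : ℕ) (v : List (Fin 4)) : Bool :=
  force (enc v) fun x => force (Nat.pow 8 v.length) fun y => withCodes H fun e =>
    [0, 1, 2, 3].all fun a => [0, 1, 2, 3].all fun b => a == b ||
      force (Nat.add (e a) (Nat.mul (Nat.pow 8 L) (e b))) fun w =>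
        (List.range (Nat.mul 2 L)).all fun i => !Nat.beq (Nat.mod (Nat.div w (Nat.pow 8 i)) y) x

theorem not_infix_of_avoidCheck {H : Fin 4 → List (Fin 4)} {L : ℕ} {v : List (Fin 4)}
    (hL : ∀ a, (H a).length = L) (hv : v ≠ []) (h : avoidCheck H L v = true) (a b : Fin 4)
    (hab : a ≠ b) : ¬ v <:+: H a ++ H b := by
  rintro ⟨s, t, hst⟩
  rw [avoidCheck, force_eq, force_eq, withCodes_eq, List.all_eq_true] at h
  have h1 := h a (by fin_cases a <;> simp)
  rw [List.all_eq_true] at h1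
  have h2 := h1 b (by fin_cases b <;> simp)
  rw [force_eq, Bool.or_eq_true, beq_iff_eq, List.all_eq_true] at h2
  have hlen := congrArg List.length hst
  have hpos := List.length_pos_iff.2 hv
  simp only [List.length_append, hL] at hlen
  have h3 := (h2.resolve_left hab) s.length (List.mem_range.2 (by change _ < 2 * L; omega))
  change (!Nat.beq ((enc (H a) + 8 ^ L * enc (H b)) / 8 ^ s.length % 8 ^ v.length) (enc v)) = true
    at h3
  rw [← hL a, ← enc_append, ← enc_drop, ← enc_take, ← hst, List.append_assoc, List.drop_left,
    List.take_left, Bool.not_eq_true', ← Bool.not_eq_true, Nat.beq_eq] at h3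
  exact h3 rfl

theorem exists_getElem?_ne_of_take_ne {α : Type} {l r : List α} {n : ℕ}
    (h : l.take n ≠ r.take n) : ∃ j < n, l[j]? ≠ r[j]? := by
  by_contra! hcon
  apply h
  apply List.ext_getElem?
  intro k
  rw [List.getElem?_take, List.getElem?_take]
  split_ifs with hk
  · exact hcon k hk
  · rfl

theorem exists_getElem?_ne_of_drop_ne {α : Type} {l r : List α} {n : ℕ}
    (h : l.drop n ≠ r.drop n) : ∃ j, n ≤ j ∧ l[j]? ≠ r[j]? := by
  by_contra! hcon
  apply h
  apply List.ext_getElem?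
  intro k
  rw [List.getElem?_drop, List.getElem?_drop]
  exact hcon _ (by omega)

theorem length_morphism (a : Fin 4) : (morphism a).length = 358 := by
  fin_cases a <;> simp [morphism, block]

/-- An 84-uniform morphism that preserves the words with all exponents below `3 / 2`. -/
def seed : Fin 4 → List (Fin 4)
  | 0 => block 84
      012032102301320312302103201302310321301203102132012310321302312013210312301320310213
  | 1 => block 84
      012032102301320312302132012310321302312013210230120321302310320130210312301320310213
  | 2 => block 84
      012032102312013021031230132102312032130231032012302132031023013210312302132012310213
  | 3 => block 84
      012032102312013210312302132031023013210312013023103213012310213203123021032012310213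

theorem length_seed (a : Fin 4) : (seed a).length = 84 := by
  fin_cases a <;> simp [seed, block]

/-! ### The images of words without large exponents -/

-- Periods above 180 are long enough for a repetition to contain a marker.
theorem directCheck_seed :
    directCheck seed 84 5 180 (fun p => Nat.div (Nat.sub p 1) 2) = true := by
  decide +kernel

theorem markCheck_seed : markCheck seed 84 3 5 [enc [0, 3, 2, 1, 0]] = true := by
  decide +kernel

theorem take_seed_ne : ∀ a b, a ≠ b → (seed a).take 23 ≠ (seed b).take 23 := by
  decide +kernel

theorem drop_seed_ne : ∀ a b, a ≠ b → (seed a).drop 65 ≠ (seed b).drop 65 := by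
  decide +kernel

-- Periods above 541 are long enough for a repetition to contain a marker.
theorem directCheck_morphism :
    directCheck morphism 358 4 541 (fun p => Nat.div (Nat.mul 7 p) 10) = true := by
  decide +kernel

theorem markCheck_morphism :
    markCheck morphism 358 25 22 [enc (((morphism 0).drop 25).take 22)] = true := by
  decide +kernel

theorem take_morphism_ne :
    ∀ a b, a ≠ b → (morphism a).take 210 ≠ (morphism b).take 210 := by
  decide +kernel

theorem drop_morphism_ne :
    ∀ a b, a ≠ b → (morphism a).drop 261 ≠ (morphism b).drop 261 := by
  decide +kernel

theorem avoidCheck_morphism : [[0, 2], [2, 0], [1, 3], [3, 1], [0, 3, 0], [2, 3, 2]].all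
    (fun v => !v.isEmpty && avoidCheck morphism 358 v) = true := by
  decide +kernel

theorem not_infix_morphism_append (a b : Fin 4) (hab : a ≠ b) (v : List (Fin 4))
    (hv : v ∈ [[0, 2], [2, 0], [1, 3], [3, 1], [0, 3, 0], [2, 3, 2]]) :
    ¬ v <:+: morphism a ++ morphism b := by
  have h := List.all_eq_true.1 avoidCheck_morphism v hv
  rw [Bool.and_eq_true] at h
  exact not_infix_of_avoidCheck length_morphism (by rintro rfl; simp at h) h.2 a b hab

theorem repBound_flatMap_seed {l : List (Fin 4)} (hl : RepBound (fun p => (p - 1) / 2) l) :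
    RepBound (fun p => (p - 1) / 2) (l.flatMap seed) := by
  refine hl.flatMap_uniform (μ := fun p => (p - 1) / 2) (P := 180) (Q := 22) (S := 18) (c := 3)
    (t := 5) (mark := fun v => enc v ∈ [enc [0, 3, 2, 1, 0]]) length_seed (by norm_num)
    (not_rep_of_directCheck length_seed directCheck_seed
      fun p hp => by omega)
    (by norm_num) (by norm_num) (by norm_num) (mark_of_markCheck length_seed markCheck_seed)
    (fun a b hab => ?_) (fun a b hab => ?_) (fun p hp => by omega) (fun q k hq hk => by omega)
  · obtain ⟨j, hj, h⟩ := exists_getElem?_ne_of_take_ne (take_seed_ne a b hab)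
    exact ⟨j, by omega, by omega, h⟩
  · obtain ⟨j, hj, h⟩ := exists_getElem?_ne_of_drop_ne (drop_seed_ne a b hab)
    refine ⟨j, ?_, by omega, h⟩
    by_contra! hcon
    rw [List.getElem?_eq_none (by rwa [length_seed]), List.getElem?_eq_none (by rwa [length_seed])]
      at h
    exact h rfl

theorem repBound_flatMap_morphism {l : List (Fin 4)} (hl : RepBound (fun p => (p - 1) / 2) l) :
    RepBound (fun p => 7 * p / 10) (l.flatMap morphism) := by
  refine hl.flatMap_uniform (μ := fun p => 7 * p / 10) (P := 541) (Q := 209) (S := 96) (c := 25)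
    (t := 22) (mark := fun v => enc v ∈ [enc (((morphism 0).drop 25).take 22)]) length_morphism
    (by norm_num)
    (not_rep_of_directCheck length_morphism directCheck_morphism
      fun p hp => by omega)
    (by norm_num) (by norm_num) (by norm_num)
    (mark_of_markCheck length_morphism markCheck_morphism)
    (fun a b hab => ?_) (fun a b hab => ?_) (fun p hp => by omega) (fun q k hq hk => by omega)
  · obtain ⟨j, hj, h⟩ := exists_getElem?_ne_of_take_ne (take_morphism_ne a b hab)
    exact ⟨j, by omega, by omega, h⟩
  · obtain ⟨j, hj, h⟩ := exists_getElem?_ne_of_drop_ne (drop_morphism_ne a b hab)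
    refine ⟨j, ?_, by omega, h⟩
    by_contra! hcon
    rw [List.getElem?_eq_none (by rwa [length_morphism]),
      List.getElem?_eq_none (by rwa [length_morphism])] at h
    exact h rfl

theorem not_infix_flatMap_morphism {l : List (Fin 4)} (hl : RepBound (fun p => (p - 1) / 2) l)
    {v : List (Fin 4)}
    (hv : v ∈ [[0, 2], [2, 0], [1, 3], [3, 1], [0, 3, 0], [2, 3, 2]]) :
    ¬ v <:+: l.flatMap morphism := by
  intro hi
  have hlen : v.length ≤ 3 := by fin_cases hv <;> simp
  obtain ⟨u, hul, hu, hvu⟩ :=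
    exists_infix_of_infix_flatMap length_morphism (by norm_num) hi (B := 2) (by omega)
  have hu' := hl.infix hul
  match u, hu, hu', hvu with
  | [], _, _, hvu =>
    have : v.length = 0 := by simpa using hvu.length_le
    fin_cases hv <;> simp at this
  | [a], _, _, hvu =>
    obtain ⟨b, hb⟩ := exists_ne a
    refine not_infix_morphism_append a b hb.symm v hv (hvu.trans ?_)
    simpa using (List.prefix_append (morphism a) (morphism b)).isInfix
  | [a, b], _, hu', hvu =>
    exact not_infix_morphism_append a b (ne_of_repBound hu' (by simp) (b := 0) rfl rfl) v hv
      (by simpa using hvu)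

/-- The image of a word with all exponents below `3 / 2` has the properties claimed for the images
of `7/5⁺`-free words. -/
theorem image_morphism {w : Word (Fin 4)}
    (hw : ∀ l, w.IsFactor l → RepBound (fun p => (p - 1) / 2) l) :
    (w.image morphism).IsDean ∧ (w.image morphism).PowerFreePlus (17 / 10) ∧
      (w.image morphism).Avoids [0, 3, 0] ∧ (w.image morphism).Avoids [2, 3, 2] := by
  have hne : ∀ a, morphism a ≠ [] := fun a h => by simpa [h] using length_morphism a
  have hrep : ∀ v, (w.image morphism).IsFactor v → RepBound (fun p => 7 * p / 10) v := by
    intro v hv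
    obtain ⟨u, hu, hvu⟩ := Word.exists_factor_of_isFactor_image hne hv
    exact (repBound_flatMap_morphism (hw u hu)).infix hvu
  have hav : ∀ v ∈ [[0, 2], [2, 0], [1, 3], [3, 1], [0, 3, 0], [2, 3, 2]],
      (w.image morphism).Avoids v := by
    intro v hv hf
    obtain ⟨u, hu, hvu⟩ := Word.exists_factor_of_isFactor_image hne hf
    exact not_infix_flatMap_morphism (hw u hu) hv hvu
  exact ⟨⟨⟨hav _ (by simp), hav _ (by simp), hav _ (by simp), hav _ (by simp)⟩,
    Word.squareFree_of_repBound hrep⟩, Word.powerFreePlus_of_repBound hrep,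
    hav _ (by simp), hav _ (by simp)⟩

/-- The infinite word that starts with `0` and is fixed by `seed`. -/
def seedWord (n : ℕ) : Fin 4 :=
  if h : n = 0 then 0 else (seed (seedWord (n / 84))).getD (n % 84) 0
termination_by n
decreasing_by exact Nat.div_lt_self (Nat.pos_of_ne_zero h) (by norm_num)

theorem seedWord_eq (n : ℕ) : seedWord n = (seed (seedWord (n / 84))).getD (n % 84) 0 := by
  by_cases h : n = 0
  · subst h
    have h0 : seedWord 0 = 0 := by rw [seedWord, dif_pos rfl]
    rw [Nat.zero_div, h0]
    decide
  · conv_lhs => rw [seedWord, dif_neg h]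

theorem map_seedWord_range (n : ℕ) : (List.range (84 * n)).map seedWord =
    ((List.range n).map seedWord).flatMap seed := by
  induction n with
  | zero => rfl
  | succ n ih =>
    have hr := List.range_add (n := 84 * n) (m := 84)
    rw [Nat.mul_succ, hr, List.map_append, ih, List.range_succ (n := n), List.map_append,
      List.flatMap_append]
    congr 1
    apply List.ext_getElem
    · simp [length_seed]
    · intro k hk hk'
      have hk84 : k < 84 := by simpa using hk
      rw [List.getElem_map, List.getElem_map, List.getElem_range, seedWord_eq,
        show (84 * n + k) / 84 = n by omega, show (84 * n + k) % 84 = k by omega,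
        List.getD_eq_getElem _ _ (by rw [length_seed]; exact hk84)]
      simp

theorem repBound_seedWord (n : ℕ) :
    RepBound (fun p => (p - 1) / 2) ((List.range n).map seedWord) := by
  induction n using Nat.strong_induction_on with
  | _ n ih =>
    by_cases hn : n < 2
    · intro i p m hp hi _
      simp only [List.length_map, List.length_range] at hi
      omega
    · have h := repBound_flatMap_seed (ih ((n + 83) / 84) (by omega))
      rw [← map_seedWord_range] at h
      refine h.infix ?_
      obtain ⟨d, hd⟩ : ∃ d, 84 * ((n + 83) / 84) = n + d := ⟨84 * ((n + 83) / 84) - n, by omega⟩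
      rw [hd, List.range_add, List.map_append]
      exact (List.prefix_append _ _).isInfix

theorem repBound_of_isFactor_seedWord {l : List (Fin 4)} (hl : (Word.inf seedWord).IsFactor l) :
    RepBound (fun p => (p - 1) / 2) l := by
  obtain ⟨i, hi⟩ := hl
  refine (repBound_seedWord (i + l.length)).infix ?_
  rw [List.range_add, List.map_append, List.map_map]
  conv_lhs => rw [hi]
  exact (List.suffix_append _ _).isInfix

/-! ### Search for admissible words -/

/-- The `17/10`-free words over `{0, 1, 2, 3}` whose adjacent letters are adjacent in the cyclic
order `0, 1, 2, 3`, and which avoid `v₁` and `v₂`. -/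
structure Admissible (v₁ v₂ l : List (Fin 4)) : Prop where
  isChain : l.IsChain fun a b => a = b + 1 ∨ a = b + 3
  repBound : RepBound (fun p => (7 * p - 1) / 10) l
  avoids₁ : ¬ v₁ <:+: l
  avoids₂ : ¬ v₂ <:+: l

theorem Admissible.infix {v₁ v₂ l r : List (Fin 4)} (h : Admissible v₁ v₂ l) (hr : r <:+: l) :
    Admissible v₁ v₂ r :=
  ⟨h.isChain.infix hr, h.repBound.infix hr, fun hv => h.avoids₁ (hv.trans hr),
    fun hv => h.avoids₂ (hv.trans hr)⟩

/-- The word with code `w` starts with a factor of period `k + 1` and of exponent at least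
`17 / 10`. -/
def repAt (w k : ℕ) : Bool :=
  Nat.beq (Nat.mod (Nat.sub w (Nat.div w (Nat.pow 8 (Nat.succ k))))
    (Nat.pow 8 (Nat.div (Nat.add (Nat.mul 7 k) 16) 10))) 0

/-- The number of letters compared for the period `k + 1` is the least `m` with
`10 * m ≥ 7 * (k + 1)`. As no digit of a code is zero, two equal residues belong to factors that
both have this length. -/
theorem repAt_eq_false {r : List (Fin 4)} (h : RepBound (fun p => (7 * p - 1) / 10) r)
    (hr : r ≠ []) (k : ℕ) : repAt (enc r) k = false := by
  by_contra hc
  rw [Bool.not_eq_false, repAt, Nat.beq_eq] at hc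
  change (enc r - enc r / 8 ^ (k + 1)) % 8 ^ ((7 * k + 16) / 10) = 0 at hc
  set m := (7 * k + 16) / 10 with hm
  have h1 : r.take m = (r.drop (k + 1)).take m := by
    apply enc_injective
    rw [enc_take, enc_take, enc_drop]
    exact ((Nat.modEq_iff_dvd' (Nat.div_le_self _ _)).2 (Nat.dvd_of_mod_eq_zero hc)).symm
  have hpos := List.length_pos_iff.2 hr
  have hlen := congrArg List.length h1
  simp only [List.length_take, List.length_drop] at hlen
  have := h 0 (k + 1) m (by omega) (by omega) fun j hj => by
    rw [Nat.zero_add, Nat.zero_add, ← List.getElem?_take_of_lt hj, h1,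
      List.getElem?_take_of_lt hj, List.getElem?_drop]
  dsimp only at this
  omega

/-- `repAt` for one of the periods `1, …, P`, short periods first. -/
def hasRep (w P : ℕ) : Bool :=
  Nat.rec (motive := fun _ => Bool) false
    (fun k ih => cond (repAt w (Nat.sub P (Nat.succ k))) true ih) P

theorem hasRep_eq_false {r : List (Fin 4)} (h : RepBound (fun p => (7 * p - 1) / 10) r)
    (hr : r ≠ []) (P : ℕ) : hasRep (enc r) P = false := by
  have : ∀ n, (Nat.rec (motive := fun _ => Bool) false
      (fun k ih => cond (repAt (enc r) (Nat.sub P (Nat.succ k))) true ih) n) = false := by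
    intro n
    induction n with
    | zero => rfl
    | succ n ih =>
      dsimp only
      rw [repAt_eq_false h hr, cond_false]
      exact ih
  exact this P

/-- The word with code `w` starts with one of the words of length 3 with codes `c₁`, `c₂`, or it
starts with a repetition of period at most `P`. -/
def excluded (c₁ c₂ P w : ℕ) : Bool :=
  cond (Nat.beq (Nat.mod w 512) c₁) true (cond (Nat.beq (Nat.mod w 512) c₂) true (hasRep w P))

theorem isPrefix_of_enc_mod {r v : List (Fin 4)} {n : ℕ}
    (h : enc r % 8 ^ n = enc v) : v <+: r := by
  rw [← enc_take] at h
  rw [← enc_injective h]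
  exact List.take_prefix _ _

theorem Admissible.excluded_eq_false {v₁ v₂ r : List (Fin 4)} (h : Admissible v₁ v₂ r)
    (hr : r ≠ []) (P : ℕ) :
    excluded (enc v₁) (enc v₂) P (enc r) = false := by
  have e₁ : Nat.beq (Nat.mod (enc r) 512) (enc v₁) = false := by
    rw [← Bool.not_eq_true, Nat.beq_eq]
    exact fun he => h.avoids₁ (isPrefix_of_enc_mod (n := 3) he).isInfix
  have e₂ : Nat.beq (Nat.mod (enc r) 512) (enc v₂) = false := by
    rw [← Bool.not_eq_true, Nat.beq_eq]
    exact fun he => h.avoids₂ (isPrefix_of_enc_mod (n := 3) he).isInfix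
  rw [excluded, e₁, e₂, cond_false, cond_false, hasRep_eq_false h.repBound hr]

/-- Depth-first search through the extensions to the left by `k` letters of the word with code
`w`: every branch meets a word for which `bad`, given the number of letters still to be added and
the code, is true. -/
def dead (bad : ℕ → ℕ → Bool) (k : ℕ) : ℕ → Bool :=
  Nat.rec (motive := fun _ => ℕ → Bool) (fun w => bad 0 w)
    (fun k ih w => cond (bad (Nat.succ k) w) true (force (Nat.mod w 4) fun a =>
      cond (forceBig (Nat.add (Nat.add 4 (Nat.mod (Nat.add a 1) 4)) (Nat.mul 8 w)) fun w' => ih w')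
        (forceBig (Nat.add (Nat.add 4 (Nat.mod (Nat.add a 3) 4)) (Nat.mul 8 w)) fun w' => ih w')
        false)) k

theorem not_dead {l r : List (Fin 4)} (hl : l.IsChain fun a b => a = b + 1 ∨ a = b + 3)
    {bad : ℕ → ℕ → Bool} {k : ℕ} (hrl : r <:+ l) (hr : r ≠ []) (hk : k + r.length = l.length)
    (hbad : ∀ s j, r <:+ s → s <:+ l → j + s.length = l.length → bad j (enc s) = false) :
    dead bad k (enc r) = false := by
  induction k generalizing r with
  | zero => exact hbad r 0 (List.suffix_refl _) hrl hk
  | succ k ih =>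
    have hd : dead bad (k + 1) (enc r) = cond (bad (k + 1) (enc r)) true
        (force (enc r % 4) fun a =>
          cond (forceBig ((4 + (a + 1) % 4) + 8 * enc r) fun w => dead bad k w)
            (forceBig ((4 + (a + 3) % 4) + 8 * enc r) fun w => dead bad k w) false) := rfl
    rw [hd, hbad r (k + 1) (List.suffix_refl _) hrl hk, cond_false, force_eq, forceBig_eq,
      forceBig_eq]
    obtain ⟨s, rfl⟩ := hrl
    have hs : s ≠ [] := by rintro rfl; simp at hk
    obtain ⟨b, r', rfl⟩ := List.exists_cons_of_ne_nil hr
    obtain ⟨s', a, rfl⟩ : ∃ s' a, s = s' ++ [a] :=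
      ⟨_, _, (List.dropLast_append_getLast hs).symm⟩
    have hsuf : a :: b :: r' <:+ s' ++ [a] ++ b :: r' := ⟨s', by simp⟩
    have hab : a = b + 1 ∨ a = b + 3 :=
      (List.isChain_cons_cons.1 (hl.suffix hsuf)).1
    have hrec : dead bad k (enc (a :: b :: r')) = false :=
      ih hsuf (by simp) (by simp at hk ⊢; omega) fun t j ht => hbad t j
        ((List.suffix_cons a _).trans ht)
    have hb : enc (b :: r') % 4 = b := by
      rw [enc_cons]; have := b.isLt; omega
    have hcode : ∀ c : ℕ, ((a : Fin 4) : ℕ) = (b + c) % 4 →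
        4 + (enc (b :: r') % 4 + c) % 4 + 8 * enc (b :: r') = enc (a :: b :: r') := by
      intro c hc
      rw [hb, ← hc, enc_cons a]; omega
    rcases hab with hab | hab
    · rw [hcode 1 (by rw [hab, Fin.val_add]; rfl), hrec, cond_false]
    · rw [hcode 3 (by rw [hab, Fin.val_add]; rfl), hrec]
      exact Bool.cond_self _ _

/-! ### Pairs of words with a short search -/

/-- Search for the words without the factors `v₁` and `v₂` of length 3: no such word of length 40
avoids `u`, and no such word with suffix `u` is longer than `u` by 150. In a word of length `n`,
only periods up to `10 * n / 17` leave room for the exponent `17 / 10`. -/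
def easyCheck (v₁ v₂ u : List (Fin 4)) : Bool :=
  force (enc v₁) fun c₁ => force (enc v₂) fun c₂ => force (enc u) fun c =>
    force (Nat.pow 8 u.length) fun q => force (Nat.add 150 u.length) fun n =>
      cond ([4, 5, 6, 7].all (dead (fun k w => cond (Nat.beq (Nat.mod w q) c) true
          (excluded c₁ c₂ (Nat.div (Nat.mul 10 (Nat.sub 40 k)) 17) w)) 39))
        (dead (fun k w => excluded c₁ c₂ (Nat.div (Nat.mul 10 (Nat.sub n k)) 17) w) 150 c) false

theorem exists_suffix_of_length_le {l : List (Fin 4)} {n : ℕ} (hn : n ≤ l.length) :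
    ∃ r, r <:+ l ∧ r.length = n :=
  ⟨l.drop (l.length - n), List.drop_suffix _ _, by simp; omega⟩

theorem length_ne_of_easyCheck {v₁ v₂ u l : List (Fin 4)} (h : easyCheck v₁ v₂ u = true)
    (hu : u ≠ []) (hl : Admissible v₁ v₂ l) : l.length ≠ 290 := by
  intro hlen
  set n := 150 + u.length with hn
  have he : easyCheck v₁ v₂ u = force (enc v₁) fun c₁ => force (enc v₂) fun c₂ =>
    force (enc u) fun c => force (8 ^ u.length) fun q => force n fun n =>
      cond ([4, 5, 6, 7].all (dead (fun k w => cond (Nat.beq (w % q) c) true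
          (excluded c₁ c₂ (10 * (40 - k) / 17) w)) 39))
        (dead (fun k w => excluded c₁ c₂ (10 * (n - k) / 17) w) 150 c) false := rfl
  rw [he, force_eq, force_eq, force_eq, force_eq, force_eq] at h
  rcases h1 : [4, 5, 6, 7].all (dead (fun k w => cond (Nat.beq (w % 8 ^ u.length) (enc u)) true
          (excluded (enc v₁) (enc v₂) (10 * (40 - k) / 17) w)) 39) with _ | _
  · rw [h1, cond_false] at h; cases h
  rw [h1, cond_true] at h
  -- a suffix of length 40 contains `u`
  obtain ⟨t, htl, ht⟩ := exists_suffix_of_length_le (l := l) (n := 40) (by omega)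
  have hut : u <:+: t := by
    by_contra hcon
    have htne : t ≠ [] := by rintro rfl; simp at ht
    have hat := hl.infix htl.isInfix
    have hlast : [t.getLast htne] <:+ t := ⟨_, List.dropLast_append_getLast htne⟩
    have hd := not_dead hat.isChain (k := 39) hlast (by simp) (by simp [ht])
      (bad := fun k w => cond (Nat.beq (w % 8 ^ u.length) (enc u)) true
          (excluded (enc v₁) (enc v₂) (10 * (40 - k) / 17) w)) fun s j hs hst _ => by
        have hsne : s ≠ [] := by rintro rfl; simp at hs
        have : Nat.beq (enc s % 8 ^ u.length) (enc u) = false := by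
          rw [← Bool.not_eq_true, Nat.beq_eq]
          exact fun he => hcon ((isPrefix_of_enc_mod he).isInfix.trans hst.isInfix)
        rw [this, cond_false, (hat.infix hst.isInfix).excluded_eq_false hsne]
    rw [List.all_eq_true] at h1
    rw [h1 _ (by generalize t.getLast htne = a; fin_cases a <;> simp [enc])] at hd
    cases hd
  -- and it is preceded by at least 250 letters
  obtain ⟨x, y, hxy⟩ := hut
  obtain ⟨z, hz⟩ := htl
  have hxul : z ++ x ++ u <:+: l := ⟨[], y, by rw [← hz, ← hxy]; simp⟩
  have hlen' := congrArg List.length hz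
  have hlenx := congrArg List.length hxy
  simp only [List.length_append] at hlen' hlenx
  obtain ⟨s, hs, hslen⟩ :=
    exists_suffix_of_length_le (l := z ++ x) (n := 150) (by rw [List.length_append]; omega)
  have hsl : s ++ u <:+: l := by
    obtain ⟨q, hq⟩ := hs
    exact List.IsInfix.trans ⟨q, [], by rw [List.append_nil, ← List.append_assoc, hq]⟩ hxul
  have has := hl.infix hsl
  have hd := not_dead has.isChain (k := 150) (List.suffix_append s u) hu (by simp [hslen])
    (bad := fun k w => excluded (enc v₁) (enc v₂) (10 * (n - k) / 17) w) fun r j hr hrs _ =>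
      (has.infix hrs.isInfix).excluded_eq_false
        (by rintro rfl; exact hu (List.suffix_nil.1 hr)) _
  rw [h] at hd
  cases hd

/-- Up to a symmetry of the cyclic order, all pairs of words of length 3 other than
`{010, 212}`, each with a word that does not occur in long admissible words for a short search. -/
def easyPairs : List (List (Fin 4) × List (Fin 4) × List (Fin 4)) :=
  [([0, 1, 0], [0, 1, 2], [2, 1]),
    ([0, 1, 0], [0, 3, 0], [1, 0]),
    ([0, 1, 0], [0, 3, 2], [0, 1, 2]),
    ([0, 1, 0], [1, 0, 1], [0, 3, 0, 1, 2]),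
    ([0, 1, 0], [1, 0, 3], [2, 3]),
    ([0, 1, 0], [1, 2, 1], [1, 0]),
    ([0, 1, 0], [1, 2, 3], [1, 0]),
    ([0, 1, 0], [2, 1, 0], [0]),
    ([0, 1, 0], [2, 3, 0], [1, 0]),
    ([0, 1, 0], [2, 3, 2], [1, 0]),
    ([0, 1, 0], [3, 0, 1], [2, 1]),
    ([0, 1, 0], [3, 2, 1], [1, 2]),
    ([0, 1, 0], [3, 2, 3], [3, 0, 3, 2, 1]),
    ([0, 1, 2], [0, 3, 2], [2]),
    ([0, 1, 2], [1, 0, 3], [3, 2]),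
    ([0, 1, 2], [1, 2, 3], [3, 2]),
    ([0, 1, 2], [2, 1, 0], [2, 3, 0]),
    ([0, 1, 2], [2, 3, 0], [2, 1]),
    ([0, 1, 2], [3, 2, 1], [1])]

theorem easyCheck_easyPairs :
    easyPairs.all (fun x => cond x.2.2.isEmpty false (easyCheck x.1 x.2.1 x.2.2)) = true := by
  decide +kernel

/-- The symmetries of the cyclic order on `{0, 1, 2, 3}`. -/
def symm (c : Fin 2 × Fin 4) (a : Fin 4) : Fin 4 :=
  if c.1 = 0 then a + c.2 else c.2 - a

theorem symm_injective (c : Fin 2 × Fin 4) : Function.Injective (symm c) := by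
  revert c; decide

theorem symm_adjacent (c : Fin 2 × Fin 4) (a b : Fin 4) (h : a = b + 1 ∨ a = b + 3) :
    symm c a = symm c b + 1 ∨ symm c a = symm c b + 3 := by
  revert c a b; decide

theorem infix_of_map_infix_map {α β : Type} {f : α → β} (hf : Function.Injective f)
    {v l : List α} (h : v.map f <:+: l.map f) : v <:+: l := by
  obtain ⟨s, t, h⟩ := h
  obtain ⟨l', t', rfl, hs, -⟩ := List.append_eq_map_iff.1 h
  obtain ⟨s', v', rfl, -, hv⟩ := List.append_eq_map_iff.1 hs.symm
  rw [List.map_injective_iff.2 hf hv.symm]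
  exact ⟨s', t', rfl⟩

theorem Admissible.map_symm {v₁ v₂ l : List (Fin 4)} (h : Admissible v₁ v₂ l)
    (c : Fin 2 × Fin 4) : Admissible (v₁.map (symm c)) (v₂.map (symm c)) (l.map (symm c)) where
  isChain := by
    rw [List.isChain_map]
    exact h.isChain.imp fun a b => symm_adjacent c a b
  repBound := h.repBound.map (symm_injective c)
  avoids₁ := fun hv => h.avoids₁ (infix_of_map_infix_map (symm_injective c) hv)
  avoids₂ := fun hv => h.avoids₂ (infix_of_map_infix_map (symm_injective c) hv)

theorem Admissible.swap {v₁ v₂ l : List (Fin 4)} (h : Admissible v₁ v₂ l) : Admissible v₂ v₁ l :=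
  ⟨h.isChain, h.repBound, h.avoids₂, h.avoids₁⟩

/-- The representative pairs of words. -/
def representatives : List (List (Fin 4) × List (Fin 4)) :=
  ([0, 1, 0], [2, 1, 2]) :: easyPairs.map fun x => (x.1, x.2.1)

/-- The words of length 3 in which adjacent letters are adjacent in the cyclic order. -/
def triples : List (List (Fin 4)) :=
  [0, 1, 2, 3].flatMap fun a => [1, 3].flatMap fun x => [1, 3].map fun y => [a, a + x, a + x + y]

theorem exists_symm_representative : ∀ v₁ ∈ triples, ∀ v₂ ∈ triples, v₁ ≠ v₂ →
    ∃ c : Fin 2 × Fin 4, (v₁.map (symm c), v₂.map (symm c)) ∈ representatives ∨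
      (v₂.map (symm c), v₁.map (symm c)) ∈ representatives := by
  decide +kernel

/-! ### Branch words and arcs -/

/-- The words of length 16 that have two extensions to the left far from the ends of an
admissible word. Only the indices `0, 1, 2, 3` are meant. -/
def branchWord : ℕ → List (Fin 4)
  | 0 => block 16 3012321012303210
  | 1 => block 16 3210301210323012
  | 2 => block 16 0123210323012103
  | _ => block 16 2103012303210123

/-- The two words that lead from a branch word to the next one on the left. -/
def arcWord : ℕ → Bool → List (Fin 4)
  | 0, false => block 15 012321032301210
  | 0, true => block 12 321030121032
  | 1, false => block 12 301232101230
  | 1, true => block 15 210301230321012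
  | 2, false => block 12 210301230321
  | 2, true => block 17 30123210123032103
  | _, false => block 12 012321032301
  | _, true => block 17 32103012103230123

/-- The index of the branch word that the arc leads to. -/
def arcTarget : ℕ → Bool → ℕ
  | 0, false => 2
  | 0, true => 1
  | 1, false => 0
  | 1, true => 3
  | 2, false => 3
  | 2, true => 0
  | _, false => 2
  | _, true => 1

/-- The codes of the factors of length 16 of the arcs with their branch words. -/
def arcWindows : List ℕ :=
  [0, 1, 2, 3].flatMap fun s => [false, true].flatMap fun k =>
    (List.range (Nat.succ (arcWord s k).length)).map fun i =>
      Nat.mod (Nat.div (enc (arcWord s k ++ branchWord s)) (Nat.pow 8 i)) (Nat.pow 8 16)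

/-- `forceList l f` is `f l`, with the elements of `l` evaluated first. -/
def forceList {α : Type} : List ℕ → (List ℕ → α) → α
  | [], f => f []
  | x :: l, f => force x fun x' => forceList l fun l' => f (x' :: l')

theorem forceList_eq {α : Type} (l : List ℕ) (f : List ℕ → α) : forceList l f = f l := by
  induction l generalizing f with
  | nil => rfl
  | cons x l ih => rw [forceList, force_eq, ih]

/-- The search for a word of length 30 whose factor of length 16 in the middle is not an arc
window. -/
def windowCheck : Bool :=
  force (enc [0, 1, 0]) fun c₁ => force (enc [2, 1, 2]) fun c₂ => forceList arcWindows fun F =>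
    [4, 5, 6, 7].all (dead (fun k w =>
      cond (excluded c₁ c₂ (Nat.div (Nat.mul 10 (Nat.sub 30 k)) 17) w) true
        (cond (Nat.beq k 0) (force (Nat.mod (Nat.div w (Nat.pow 8 7)) (Nat.pow 8 16)) fun v =>
          F.any fun x => Nat.beq v x) false)) 29)

/-- The search for a word of 17 letters to the left of a branch word in which all windows are arc
windows, but which does not end with an arc. The longest arcs have 17 letters. -/
def arcCheck : Bool :=
  forceList arcWindows fun F => [0, 1, 2, 3].all fun s =>
    force (enc (arcWord s false ++ branchWord s)) fun d₁ =>
      force (enc (arcWord s true ++ branchWord s)) fun d₂ =>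
        dead (fun _ w => cond (Nat.beq w d₁) true (cond (Nat.beq w d₂) true
          (force (Nat.mod w (Nat.pow 8 16)) fun v => cond (F.any fun x => Nat.beq v x) false true)))
          17 (enc (branchWord s))

theorem windowCheck_eq_true : windowCheck = true := by
  decide +kernel

theorem arcCheck_eq_true : arcCheck = true := by
  decide +kernel

/-- In the middle of a word of length 30 only arc windows are possible. -/
theorem enc_mem_arcWindows {l : List (Fin 4)} (hl : Admissible [0, 1, 0] [2, 1, 2] l)
    (hlen : l.length = 30) : enc ((l.drop 7).take 16) ∈ arcWindows := by
  by_contra hcon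
  have h := windowCheck_eq_true
  rw [windowCheck, force_eq, force_eq, forceList_eq, List.all_eq_true] at h
  have hne : l ≠ [] := by rintro rfl; simp at hlen
  have hd := not_dead hl.isChain (k := 29) (r := [l.getLast hne])
    ⟨_, List.dropLast_append_getLast hne⟩ (by simp) (by simp [hlen])
    (bad := fun k w =>
      cond (excluded (enc [0, 1, 0]) (enc [2, 1, 2]) (10 * (30 - k) / 17) w) true
        (cond (Nat.beq k 0) (force (w / 8 ^ 7 % 8 ^ 16) fun v =>
          arcWindows.any fun x => Nat.beq v x) false)) fun s j hs hsl hj => by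
      have hsne : s ≠ [] := by rintro rfl; simp at hs
      rw [(hl.infix hsl.isInfix).excluded_eq_false hsne, cond_false]
      rcases hj0 : Nat.beq j 0 with _ | _
      · rfl
      · rw [Nat.beq_eq] at hj0
        obtain rfl : s = l := hsl.eq_of_length (by omega)
        rw [cond_true, force_eq, ← enc_drop, ← enc_take, ← Bool.not_eq_true, List.any_eq_true]
        rintro ⟨x, hx, he⟩
        rw [Nat.beq_eq] at he
        exact hcon (he ▸ hx)
  have h1 := h (enc [l.getLast hne]) (by
    generalize l.getLast hne = a; fin_cases a <;> simp [enc])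
  cases h1.symm.trans hd

/-- To the left of a branch word there is one of its two arcs, if there are enough letters on
both sides. -/
theorem exists_arcWord_suffix {x z : List (Fin 4)} {s : ℕ} (hs : s < 4)
    (hl : Admissible [0, 1, 0] [2, 1, 2] (x ++ branchWord s ++ z)) (hx : x.length = 24)
    (hz : z.length = 7) : ∃ k, arcWord s k <:+ x := by
  by_contra! hcon
  have h := arcCheck_eq_true
  rw [arcCheck, forceList_eq, List.all_eq_true] at h
  have h1 := h s (by interval_cases s <;> simp)
  rw [force_eq, force_eq] at h1
  have hb : (branchWord s).length = 16 := by
    interval_cases s <;> rfl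
  have hm := hl.infix (r := x.drop 7 ++ branchWord s)
    ⟨x.take 7, z, by rw [← List.append_assoc, List.take_append_drop]⟩
  have hbne : branchWord s ≠ [] := by intro h; simp [h] at hb
  have hk : ∀ k, ∀ r, branchWord s <:+ r → r <:+ x.drop 7 ++ branchWord s →
      Nat.beq (enc r) (enc (arcWord s k ++ branchWord s)) = false := by
    intro k r _ hr
    rw [← Bool.not_eq_true, Nat.beq_eq]
    intro he
    rw [enc_injective he] at hr
    exact hcon k ((List.suffix_append_self_iff.1 hr).trans (List.drop_suffix _ _))
  have hd := not_dead hm.isChain (k := 17) (List.suffix_append _ _) hbne (by simp [hx])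
    (bad := fun _ w => cond (Nat.beq w (enc (arcWord s false ++ branchWord s))) true
      (cond (Nat.beq w (enc (arcWord s true ++ branchWord s))) true
        (force (w % 8 ^ 16) fun v =>
          cond (arcWindows.any fun x => Nat.beq v x) false true))) fun r j hr hrm hj => by
      rw [hk _ r hr hrm, hk _ r hr hrm, cond_false, cond_false, force_eq]
      have : (arcWindows.any fun x => Nat.beq (enc r % 8 ^ 16) x) = true := by
        rw [List.any_eq_true]
        refine ⟨_, ?_, by rw [Nat.beq_eq]⟩
        -- the window at the left end of `r` with seven more letters on both sides
        obtain ⟨t, ht⟩ := hrm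
        have hrlen := hr.length_le
        have htlen := congrArg List.length ht
        simp only [List.length_append, List.length_drop, hx] at htlen
        have hdec : x ++ branchWord s ++ z = x.take 7 ++ t ++ (r ++ z) := by
          rw [← List.append_assoc _ r, List.append_assoc _ t r, ht, ← List.append_assoc,
            List.take_append_drop]
        have hpre : (x.take 7 ++ t).length = 7 + t.length := by simp [hx]
        have hw : (((x ++ branchWord s ++ z).drop t.length).take 30) <:+: x ++ branchWord s ++ z :=
          (List.take_prefix _ _).isInfix.trans (List.drop_suffix _ _).isInfix
        have := enc_mem_arcWindows (hl.infix hw) (by simp [hx, hz, hb]; omega)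
        rw [List.drop_take, List.take_take, List.drop_drop, hdec, Nat.add_comm t.length, ← hpre,
          List.drop_left, List.take_append_of_le_length (by omega)] at this
        rw [← enc_take]
        exact this
      rw [this, cond_true]
  cases h1.symm.trans hd

/-! ### Search along the arcs -/

/-- The end of the search, to the left of the last branch word: `m` letters are missing at that
branch word, and the numbers in `ms` are missing at the earlier ones, so the numbers `x - m` are
the distances of the last branch word to the earlier ones. Besides these, only periods up to 24 are
tried before the word is complete, and those up to 169 suffice for complete words. -/
def endBad (ms : List ℕ) (m k w : ℕ) : Bool :=
  cond (excluded (enc [0, 1, 0]) (enc [2, 1, 2]) 24 w) true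
    (cond (ms.any fun x => repAt w (Nat.sub (Nat.sub x m) 1)) true
      (cond (Nat.beq k 0) (hasRep w 169) false))

/-- The search through the extensions to the left by `m` letters of the word with code `w`, which
starts with the branch word `s`. Only arcs are added as long as 24 letters are missing, 17 for the
longest arc and seven more that force it. At the branch words, only
the distances to the earlier branch words are tried as periods; the list `ms` consists of the
numbers of letters that were missing there. -/
def branchSearch (n : ℕ) : ℕ → List ℕ → ℕ → ℕ → Bool :=
  Nat.rec (motive := fun _ => ℕ → List ℕ → ℕ → ℕ → Bool) (fun _ _ _ _ => false)
    (fun _ ih s ms m w => cond (ms.any fun x => repAt w (Nat.sub (Nat.sub x m) 1)) true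
      (cond (Nat.ble 24 m)
        ([false, true].all fun k => force (arcTarget s k) fun s' =>
          force (Nat.sub m (arcWord s k).length) fun m' =>
            forceBig (Nat.add (enc (arcWord s k)) (Nat.mul (Nat.pow 8 (arcWord s k).length) w))
              fun w' => ih s' (m :: ms) m' w')
        (dead (endBad ms m) m w))) n

/-- The search for words of length 290: letter by letter up to the first branch word that is
followed by at least seven letters (`k ≤ 290 - 16 - 7`), then along the arcs. -/
def startBad (k w : ℕ) : Bool :=
  cond (excluded (enc [0, 1, 0]) (enc [2, 1, 2]) (Nat.div (Nat.mul 10 (Nat.sub 290 k)) 17) w) true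
    (cond (Nat.ble k 267) ([0, 1, 2, 3].any fun s =>
      cond (Nat.beq (Nat.mod w (Nat.pow 8 16)) (enc (branchWord s))) (branchSearch 30 s [] k w)
        false) false)

theorem dead_startBad : cond (dead startBad 289 (enc [0]))
    (cond (dead startBad 288 (enc [0, 1])) (dead startBad 288 (enc [0, 3])) false) false = true := by
  decide +kernel

theorem exists_arcWord_append_branchWord {s : ℕ} (hs : s < 4) (k : Bool) :
    arcTarget s k < 4 ∧ ∃ t, arcWord s k ++ branchWord s = branchWord (arcTarget s k) ++ t := by
  have : ∀ s < 4, ∀ k, arcTarget s k < 4 ∧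
      branchWord (arcTarget s k) <+: arcWord s k ++ branchWord s := by
    decide +kernel
  obtain ⟨h, t, ht⟩ := this s hs k
  exact ⟨h, t, ht.symm⟩

theorem any_repAt_eq_false {v₁ v₂ r : List (Fin 4)} (h : Admissible v₁ v₂ r) (hr : r ≠ [])
    (ms : List ℕ) (m : ℕ) : (ms.any fun x => repAt (enc r) (Nat.sub (Nat.sub x m) 1)) = false := by
  rw [List.any_eq_false]
  intro x _
  rw [repAt_eq_false h.repBound hr]
  exact Bool.false_ne_true

theorem branchWord_ne_nil (s : ℕ) : branchWord s ≠ [] := by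
  rcases s with _ | _ | _ | s <;> simp [branchWord, block]

theorem branchSearch_eq_false {l : List (Fin 4)} (hl : Admissible [0, 1, 0] [2, 1, 2] l)
    {n s m : ℕ} {ms : List ℕ} {y : List (Fin 4)} (hs : s < 4) (hy : 7 ≤ y.length)
    (hr : branchWord s ++ y <:+ l) (hm : m + (branchWord s ++ y).length = l.length) :
    branchSearch n s ms m (enc (branchWord s ++ y)) = false := by
  induction n generalizing s m ms y with
  | zero => rfl
  | succ n ih =>
    have he : ∀ w, branchSearch (n + 1) s ms m w =
      cond (ms.any fun x => repAt w (Nat.sub (Nat.sub x m) 1)) true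
      (cond (Nat.ble 24 m)
        ([false, true].all fun k => force (arcTarget s k) fun s' =>
          force (m - (arcWord s k).length) fun m' =>
            forceBig (enc (arcWord s k) + 8 ^ (arcWord s k).length * w)
              fun w' => branchSearch n s' (m :: ms) m' w')
        (dead (endBad ms m) m w)) := fun w => rfl
    have hne : branchWord s ++ y ≠ [] := by simp [branchWord_ne_nil]
    rw [he, any_repAt_eq_false (hl.infix hr.isInfix) hne, cond_false]
    rcases hm24 : Nat.ble 24 m with _ | _
    · rw [cond_false]
      refine not_dead hl.isChain hr hne hm fun t j ht htl _ => ?_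
      have htne : t ≠ [] := by rintro rfl; exact hne (List.suffix_nil.1 ht)
      have hat := hl.infix htl.isInfix
      rw [endBad, hat.excluded_eq_false htne, cond_false, any_repAt_eq_false hat htne, cond_false,
        hasRep_eq_false hat.repBound htne, Bool.cond_self]
    · have hm' : 24 ≤ m := Nat.le_of_ble_eq_true hm24
      rw [cond_true]
      obtain ⟨p, rfl⟩ := hr
      have hp : p.length = m := by
        simp only [List.length_append] at hm; omega
      obtain ⟨k, x, hk⟩ := exists_arcWord_suffix (x := p.drop (m - 24)) (z := y.take 7) hs
        (hl.infix ⟨p.take (m - 24), y.drop 7, by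
          rw [List.append_assoc, List.append_assoc, List.append_assoc, List.take_append_drop,
            ← List.append_assoc, List.take_append_drop]⟩)
        (by rw [List.length_drop]; omega) (by rw [List.length_take]; omega)
      obtain ⟨hs', t, ht⟩ := exists_arcWord_append_branchWord hs k
      have hty : arcWord s k ++ (branchWord s ++ y) =
          branchWord (arcTarget s k) ++ (t ++ y) := by
        rw [← List.append_assoc, ht, List.append_assoc]
      have hsuf : arcWord s k ++ (branchWord s ++ y) <:+ p ++ (branchWord s ++ y) :=
        ⟨p.take (m - 24) ++ x, by
          rw [List.append_assoc, ← List.append_assoc x, hk, ← List.append_assoc,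
            List.take_append_drop]⟩
      have hkl := congrArg List.length hk
      rw [List.length_append, List.length_drop] at hkl
      rw [List.all_eq_false]
      refine ⟨k, by cases k <;> simp, ?_⟩
      rw [force_eq, force_eq, forceBig_eq, ← enc_append, hty, Bool.not_eq_true]
      refine ih hs' (by rw [List.length_append]; omega) (hty ▸ hsuf) ?_
      rw [← hty]
      simp only [List.length_append]
      omega

theorem startBad_eq_false {l r : List (Fin 4)} (hl : Admissible [0, 1, 0] [2, 1, 2] l)
    (hlen : l.length = 290) (hr : r ≠ []) {k : ℕ} (hrl : r <:+ l) (hk : k + r.length = l.length) :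
    startBad k (enc r) = false := by
  rw [startBad, (hl.infix hrl.isInfix).excluded_eq_false hr, cond_false]
  rcases hk267 : Nat.ble k 267 with _ | _
  · rfl
  rw [cond_true, List.any_eq_false]
  intro s hs
  have hs' : s < 4 := by simp at hs; omega
  rcases hc : Nat.beq (Nat.mod (enc r) (Nat.pow 8 16)) (enc (branchWord s)) with _ | _
  · rw [cond_false]; exact Bool.false_ne_true
  rw [Nat.beq_eq] at hc
  obtain ⟨y, rfl⟩ := isPrefix_of_enc_mod hc
  have hb : (branchWord s).length = 16 := by interval_cases s <;> rfl
  have := Nat.le_of_ble_eq_true hk267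
  rw [cond_true, branchSearch_eq_false hl hs' ?_ hrl hk]
  · exact Bool.false_ne_true
  · rw [List.length_append] at hk; omega

theorem not_suffix_of_dead {l r : List (Fin 4)} (hl : Admissible [0, 1, 0] [2, 1, 2] l)
    (hlen : l.length = 290) (hr : r ≠ []) {k : ℕ} (hk : k + r.length = 290)
    (hd : dead startBad k (enc r) = true) : ¬ r <:+ l := by
  intro hrl
  rw [not_dead hl.isChain hrl hr (hk.trans hlen.symm) fun s j hs hsl hj =>
    startBad_eq_false hl hlen (by rintro rfl; exact hr (List.suffix_nil.1 hs)) hsl hj] at hd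
  cases hd

/-- The pair `{010, 212}`. Its reflection allows to assume that the last even letter among the last
two letters is `0`. -/
theorem Admissible.length_ne {l : List (Fin 4)} (hl : Admissible [0, 1, 0] [2, 1, 2] l) :
    l.length ≠ 290 := by
  intro hlen
  have hd := dead_startBad
  simp only [Bool.cond_false_right, Bool.and_eq_true] at hd
  -- the reflection that exchanges `0` and `2` exchanges the two words
  have key : ∀ {l : List (Fin 4)}, Admissible [0, 1, 0] [2, 1, 2] l → l.length = 290 →
      ¬ [0] <:+ l ∧ ¬ [0, 1] <:+ l ∧ ¬ [0, 3] <:+ l := fun hl hlen =>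
    ⟨not_suffix_of_dead hl hlen (by simp) rfl hd.1,
      not_suffix_of_dead hl hlen (by simp) rfl hd.2.1,
      not_suffix_of_dead hl hlen (by simp) rfl hd.2.2⟩
  have h1 := key hl hlen
  have h2 := key (hl.map_symm (1, 2)).swap (by rw [List.length_map, hlen])
  have hsuf : ∀ {r}, r <:+ l → r.map (symm (1, 2)) <:+ l.map (symm (1, 2)) := fun h => h.map _
  obtain ⟨r, hrl, hrlen⟩ := exists_suffix_of_length_le (l := l) (n := 2) (by omega)
  obtain ⟨a, b, rfl⟩ := List.length_eq_two.1 hrlen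
  have hab : a = b + 1 ∨ a = b + 3 := by
    simpa using hl.isChain.suffix hrl
  have hb : [b] <:+ l := (List.suffix_cons a [b]).trans hrl
  have g1 := hsuf hrl
  have g2 := hsuf hb
  fin_cases b <;> rcases hab with rfl | rfl
  all_goals first
    | exact h1.1 hb
    | exact h1.2.1 hrl
    | exact h1.2.2 hrl
    | exact h2.1 g2
    | exact h2.2.1 g1
    | exact h2.2.2 g1

/-! ### Dean words with two minimal absent words -/

theorem Admissible.length_ne_of_mem_representatives {v₁ v₂ l : List (Fin 4)}
    (hl : Admissible v₁ v₂ l) (hv : (v₁, v₂) ∈ representatives) : l.length ≠ 290 := by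
  rw [representatives, List.mem_cons, Prod.mk.injEq, List.mem_map] at hv
  rcases hv with ⟨rfl, rfl⟩ | ⟨⟨w₁, w₂, u⟩, hx, he⟩
  · exact hl.length_ne
  · cases he
    have h := List.all_eq_true.1 easyCheck_easyPairs _ hx
    cases u with
    | nil => cases h
    | cons a u => exact length_ne_of_easyCheck h (List.cons_ne_nil _ _) hl

theorem Admissible.length_ne_of_mem_triples {v₁ v₂ l : List (Fin 4)} (hl : Admissible v₁ v₂ l)
    (h₁ : v₁ ∈ triples) (h₂ : v₂ ∈ triples) (hv : v₁ ≠ v₂) : l.length ≠ 290 := by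
  obtain ⟨c, h | h⟩ := exists_symm_representative v₁ h₁ v₂ h₂ hv
  · simpa using (hl.map_symm c).length_ne_of_mem_representatives h
  · simpa using (hl.map_symm c).swap.length_ne_of_mem_representatives h

namespace Word

theorem IsDean.adjacent {w : Word (Fin 4)} (hw : w.IsDean) {a b : Fin 4}
    (h : w.IsFactor [a, b]) : a = b + 1 ∨ a = b + 3 := by
  have h1 := hw.1.1
  have h2 := hw.1.2.1
  have h3 := hw.1.2.2.1
  have h4 := hw.1.2.2.2
  have h5 := hw.2 [a] (by simp)
  revert h h1 h2 h3 h4 h5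
  simp only [Avoids, List.singleton_append]
  fin_cases a <;> fin_cases b <;> first | (intros; decide) | (intros; contradiction)

theorem IsDean.mem_triples {w : Word (Fin 4)} (hw : w.IsDean) {v : List (Fin 4)}
    (hv : v ∈ w.minimalAbsent 3) : v ∈ triples := by
  obtain ⟨hlen, -, hf⟩ := hv
  obtain ⟨a, b, c, rfl⟩ := List.length_eq_three.1 hlen
  have h1 := hw.adjacent (hf [a, b] (Or.inl ⟨[c], rfl⟩) (by simp))
  have h2 := hw.adjacent (hf [b, c] (Or.inr ⟨[a], rfl⟩) (by simp))
  have : ∀ a b c : Fin 4, (a = b + 1 ∨ a = b + 3) → (b = c + 1 ∨ b = c + 3) →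
      [a, b, c] ∈ triples := by
    decide +kernel
  exact this a b c h1 h2

theorem IsDean.isChain {w : Word (Fin 4)} (hw : w.IsDean) {l : List (Fin 4)}
    (hl : w.IsFactor l) : l.IsChain fun a b => a = b + 1 ∨ a = b + 3 :=
  (List.isChain_isInfix l).imp fun _ _ h => hw.adjacent (hl.infix h)

theorem IsDean.length_lt {w : Word (Fin 4)} (hw : w.IsDean) (hf : w.PowerFree (17 / 10))
    (hn : 2 ≤ w.numMinimalAbsent 3) : w.length < 290 := by
  by_contra! hlen
  obtain ⟨l, hl, hll⟩ := exists_factor_of_le_length (n := 290) hlen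
  obtain ⟨v₁, h₁, v₂, h₂, hv⟩ : ∃ v₁ ∈ w.minimalAbsent 3, ∃ v₂ ∈ w.minimalAbsent 3, v₁ ≠ v₂ :=
    (Set.one_lt_ncard (Set.finite_of_ncard_pos (by
      rw [numMinimalAbsent] at hn; omega))).1 hn
  refine Admissible.length_ne_of_mem_triples (l := l) ⟨hw.isChain hl, hf.repBound hl, ?_, ?_⟩
    (hw.mem_triples h₁) (hw.mem_triples h₂) hv hll
  · exact fun h => h₁.2.1 (hl.infix h)
  · exact fun h => h₂.2.1 (hl.infix h)

end Word

end DeanWord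

theorem mainTheorem9 :
    -- There is an infinite `17/10⁺`-free Dean word avoiding `030` and `232`.
    (∃ s : ℕ → Fin 4,
      (DeanWord.Word.inf s).IsDean ∧
      (DeanWord.Word.inf s).PowerFreePlus (17 / 10) ∧
      (DeanWord.Word.inf s).Avoids [0, 3, 0] ∧
      (DeanWord.Word.inf s).Avoids [2, 3, 2]) ∧
    -- The morphism is 358-uniform.
    (∀ a : Fin 4, (DeanWord.morphism a).length = 358) ∧
    -- The image of every (finite or infinite) `7/5⁺`-free word is such a word.
    (∀ w : DeanWord.Word (Fin 4), w.PowerFreePlus (7 / 5) →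
      (w.image DeanWord.morphism).IsDean ∧
      (w.image DeanWord.morphism).PowerFreePlus (17 / 10) ∧
      (w.image DeanWord.morphism).Avoids [0, 3, 0] ∧
      (w.image DeanWord.morphism).Avoids [2, 3, 2]) ∧
    -- `17/10`-free Dean words with at least two minimal absent words of length 3 are short.
    (∀ w : DeanWord.Word (Fin 4), w.IsDean → w.PowerFree (17 / 10) →
      2 ≤ w.numMinimalAbsent 3 → w.length < 290) := by
  refine ⟨⟨_, DeanWord.image_morphism (w := .inf DeanWord.seedWord) fun l hl =>
      DeanWord.repBound_of_isFactor_seedWord hl⟩, DeanWord.length_morphism,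
    fun w hw => DeanWord.image_morphism fun l hl => hw.repBound hl,
    fun w hw hf hn => hw.length_lt hf hn⟩
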